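/- Let $T>0$. For a complex-valued $\sigma\in L_2(0,T)$ put $y^{[1]}:=y'-\sigma y$ and consider $$-(y^{[1]})'-\sigma y^{[1]}-\sigma^2y=\lambda y\quad\text{a.e. on }(0,T),\qquad y,\,y^{[1]}\in AC[0,T].$$ Let $\varphi(x,\lambda)$ and $S(x,\lambda)$ be the solutions with $\varphi(0,\lambda)=S^{[1]}(0,\lambda)=1$ and $\varphi^{[1]}(0,\lambda)=S(0,\lambda)=0$. Put $c(x):=\varphi^{[1]}(x,0)$ and let $\eta(x,\rho)$ be defined by $$\varphi^{[1]}(x,\rho^2)=-\rho\sin\rho x+\rho\,\eta(x,\rho)+c(x).$$ There are functions $\mathcal K(x,\cdot)=\mathcal K_\sigma(x,\cdot)$ and $\mathcal N(x,\cdot)=\mathcal N_\sigma(x,\cdot)$ in $L_2(0,x)$ (the transformation kernels), assigned to every complex-valued $\sigma\in L_2(0,T)$ and every $x\in(0,T]$, with the following two properties. (1) For all such $\sigma$, $x$ and all $\rho\in\mathbb C$ $$\varphi(x,\rho^2)=\cos\rho x+\int_0^x\mathcal K(x,t)\cos\rho t\,dt,\qquad \varphi^{[1]}(x,\rho^2)=-\rho\sin\rho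 x+\rho\int_0^x\mathcal N(x,t)\sin\rho t\,dt+c(x).$$ (2) For every $\Omega>0$ there is a constant $C$, depending only on $\Omega$ and $T$, such that for all complex-valued $\sigma,\tilde\sigma\in L_2(0,T)$ with $\|\sigma\|_{L_2(0,T)}\le\Omega$ and $\|\tilde\sigma\|_{L_2(0,T)}\le\Omega$, and for every $x\in(0,T]$, the functions of $\rho\in\mathbb R$ below belong to $L_2(\mathbb R)$ and $$\|\rho\hat S(x,\rho^2)\|_{L_2(\mathbb R)}\le C\|\hat\sigma\|_{L_2(0,x)},\qquad \|\hat S^{[1]}(x,\rho^2)\|_{L_2(\mathbb R)}\le C\|\hat\sigma\|_{L_2(0,x)},$$ $$\|\hat\varphi(x,\rho^2)\|_{L_2(\mathbb R)}\le C\|\hat\sigma\|_{L_2(0,x)},\qquad \|\hat\eta(x,\rho)\|_{L_2(\mathbb R)}+|\hat c(x)|\le C\|\hat\sigma\|_{L_2(0,x)},$$ $$\|\hat{\mathcal K}(x,\cdot)\|_{L_2(0,x)}\le C\|\hat\sigma\|_{L_2(0,x)},\qquad \|\hat{\mathcal N}(x,\cdot)\|_{L_2(0,x)}\le C\|\hat\sigma\|_{L_2(0,x)}.$$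 Here $\tilde\alpha$ denotes the object $\alpha$ built from $\tilde\sigma$ instead of $\sigma$, and $\hat\alpha:=\alpha-\tilde\alpha$. -/

import Mathlib

open MeasureTheory Set Filter Topology
open scoped NNReal ENNReal

namespace SturmLiouville

/-- `y` solves `-(y^{[1]})' - σ y^{[1]} - σ² y = lam y` on `(0, T)`, where `y^{[1]} = y' - σ y` is
the quasi-derivative. Both `y` and `y^{[1]}` are required to be absolutely continuous on `[0, T]`;
`y₁` is the absolutely continuous representative of `y^{[1]}`. -/
structure IsSolution (T : ℝ) (σ : ℝ → ℂ) (lam : ℂ) (y y₁ : ℝ → ℂ) : Prop where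
  ac : AbsolutelyContinuousOnInterval y 0 T
  ac_quasi : AbsolutelyContinuousOnInterval y₁ 0 T
  quasi : ∀ᵐ x ∂volume.restrict (Ioo 0 T), ∃ y' : ℂ, HasDerivAt y y' x ∧ y₁ x = y' - σ x * y x
  eqn : ∀ᵐ x ∂volume.restrict (Ioo 0 T), ∃ y₁' : ℂ, HasDerivAt y₁ y₁' x ∧
    -y₁' - σ x * y₁ x - σ x ^ 2 * y x = lam * y x

/-! Existence and uniqueness for the Cauchy problem with a potential in `L²(0, T)`. -/

theorem exists_weight (g : ℝ → ℝ) (hg : Integrable g) (h0 : ∀ t, 0 ≤ g t) :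
    ∃ k : ℝ, 0 < k ∧ ∀ x : ℝ, 0 ≤ x → ∫ t in (0:ℝ)..x, Real.exp (-(k * (x - t))) * g t ≤ 1 / 2 := by
  have hlim : Tendsto (fun n : ℕ => ∫ t, (g t - min (g t) n)) atTop (𝓝 (∫ _ : ℝ, (0:ℝ))) := by
    apply tendsto_integral_of_dominated_convergence g
    · intro n
      exact hg.1.sub (hg.1.inf aestronglyMeasurable_const)
    · exact hg
    · intro n
      refine Eventually.of_forall fun t => ?_
      have hn : (0:ℝ) ≤ n := Nat.cast_nonneg n
      have := le_min (h0 t) hn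
      rw [Real.norm_eq_abs, abs_of_nonneg (by linarith [min_le_left (g t) (n:ℝ)])]
      linarith
    · refine Eventually.of_forall fun t => ?_
      apply tendsto_const_nhds.congr'
      filter_upwards [eventually_ge_atTop (Nat.ceil (g t))] with n hn
      rw [min_eq_left ((Nat.le_ceil _).trans (by exact_mod_cast hn)), sub_self]
  simp only [integral_zero] at hlim
  obtain ⟨n, hn⟩ := (hlim.eventually (gt_mem_nhds (by norm_num : (0:ℝ) < 1/4))).exists
  have hn0 : (0:ℝ) ≤ n := Nat.cast_nonneg n
  have hmI : Integrable (fun t => g t - min (g t) n) := by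
    refine hg.mono (hg.1.sub (hg.1.inf aestronglyMeasurable_const)) (Eventually.of_forall fun t => ?_)
    have := le_min (h0 t) hn0
    rw [Real.norm_eq_abs, Real.norm_eq_abs, abs_of_nonneg (h0 t),
      abs_of_nonneg (by linarith [min_le_left (g t) (n:ℝ)])]
    linarith
  refine ⟨4 * n + 1, by positivity, fun x hx => ?_⟩
  set k : ℝ := 4 * n + 1 with hk
  have hkpos : 0 < k := by positivity
  have hcont : Continuous fun t : ℝ => Real.exp (-(k * (x - t))) := by fun_prop
  have hI1 : IntervalIntegrable (fun t => Real.exp (-(k * (x - t))) * g t) volume 0 x :=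
    hg.intervalIntegrable.continuousOn_mul hcont.continuousOn
  have hI2 : IntervalIntegrable (fun t => (g t - min (g t) n) + Real.exp (-(k * (x - t))) * n)
      volume 0 x :=
    hmI.intervalIntegrable.add ((hcont.mul continuous_const).intervalIntegrable _ _)
  have h1 : ∫ t in (0:ℝ)..x, Real.exp (-(k * (x - t))) * g t ≤
      ∫ t in (0:ℝ)..x, ((g t - min (g t) n) + Real.exp (-(k * (x - t))) * n) := by
    apply intervalIntegral.integral_mono_on hx hI1 hI2
    intro t ht
    have e0 := Real.exp_pos (-(k * (x - t)))
    have e1 : Real.exp (-(k * (x - t))) ≤ 1 := by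
      rw [Real.exp_le_one_iff]
      have : 0 ≤ k * (x - t) := mul_nonneg hkpos.le (by linarith [ht.2])
      linarith
    have := min_le_left (g t) (n:ℝ)
    have := min_le_right (g t) (n:ℝ)
    nlinarith
  have h2 : ∫ t in (0:ℝ)..x, (g t - min (g t) n) ≤ 1 / 4 := by
    rw [intervalIntegral.integral_of_le hx]
    refine (setIntegral_le_integral hmI (Eventually.of_forall fun t => ?_)).trans hn.le
    simp
  have h3 : ∫ t in (0:ℝ)..x, Real.exp (-(k * (x - t))) = (1 - Real.exp (-(k * x))) / k := by
    have : ∀ t ∈ uIcc (0:ℝ) x, HasDerivAt (fun t => Real.exp (-(k * (x - t))) / k)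
        (Real.exp (-(k * (x - t)))) t := by
      intro t _
      have h := ((((hasDerivAt_id t).const_sub x).const_mul k).neg.exp).div_const k
      convert! h using 1
      field_simp
      simp
    rw [intervalIntegral.integral_eq_sub_of_hasDerivAt this (hcont.intervalIntegrable _ _)]
    simp
    ring
  have hI3 : IntervalIntegrable (fun t => Real.exp (-(k * (x - t))) * n) volume 0 x :=
    (hcont.mul continuous_const).intervalIntegrable _ _
  rw [intervalIntegral.integral_add hmI.intervalIntegrable hI3,
    intervalIntegral.integral_mul_const, h3] at h1
  have h4 : (1 - Real.exp (-(k * x))) / k * n ≤ 1 / 4 := by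
    have := Real.exp_pos (-(k * x))
    rw [div_mul_eq_mul_div, div_le_iff₀ hkpos]
    nlinarith
  linarith

section volterra
variable {E : Type} [NormedAddCommGroup E] [NormedSpace ℝ E]

theorem intervalIntegrable_apply {A : ℝ → E →L[ℝ] E} (hA : Integrable A) {Y : ℝ → E}
    (hY : Continuous Y) (a b : ℝ) : IntervalIntegrable (fun t => A t (Y t)) volume a b := by
  obtain ⟨M, hM⟩ := (isCompact_uIcc (a := a) (b := b)).exists_bound_of_continuousOn hY.continuousOn
  refine (hA.norm.intervalIntegrable.mul_const M).mono_fun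
    (isBoundedBilinearMap_apply.continuous.comp_aestronglyMeasurable
      (hA.1.prodMk hY.aestronglyMeasurable)).restrict ?_
  refine (ae_restrict_mem measurableSet_uIoc).mono fun t ht => ?_
  have h1 := hM t (uIoc_subset_uIcc ht)
  have h2 := (A t).le_opNorm (Y t)
  have h3 : ‖A t‖ * ‖Y t‖ ≤ ‖A t‖ * M := mul_le_mul_of_nonneg_left h1 (norm_nonneg _)
  exact (h2.trans h3).trans (le_abs_self _)

theorem volterra_bound {A : ℝ → E →L[ℝ] E} (hA : Integrable A) {k : ℝ}
    (hk : ∀ x : ℝ, 0 ≤ x → ∫ t in (0:ℝ)..x, Real.exp (-(k * (x - t))) * ‖A t‖ ≤ 1 / 2)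
    {Z : ℝ → E} {m T : ℝ} (hm : ∀ x ∈ Icc 0 T, ‖Z x‖ ≤ Real.exp (k * x) * m)
    {x : ℝ} (hx : x ∈ Icc 0 T) (hm0 : 0 ≤ m) :
    ‖∫ t in (0:ℝ)..x, A t (Z t)‖ ≤ Real.exp (k * x) * (m / 2) := by
  have hcont : Continuous fun t : ℝ => Real.exp (-(k * (x - t))) := by fun_prop
  have hI1 : IntervalIntegrable (fun t => Real.exp (-(k * (x - t))) * ‖A t‖) volume 0 x :=
    hA.norm.intervalIntegrable.continuousOn_mul hcont.continuousOn
  have h1 : ‖∫ t in (0:ℝ)..x, A t (Z t)‖ ≤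
      ∫ t in (0:ℝ)..x, (Real.exp (k * x) * m) * (Real.exp (-(k * (x - t))) * ‖A t‖) := by
    apply intervalIntegral.norm_integral_le_of_norm_le hx.1 _ (hI1.const_mul _)
    refine Eventually.of_forall fun t ht => ?_
    have e : Real.exp (k * t) = Real.exp (k * x) * Real.exp (-(k * (x - t))) := by
      rw [← Real.exp_add]; congr 1; ring
    have h2 := hm t ⟨ht.1.le, ht.2.trans hx.2⟩
    have h3 := (A t).le_opNorm (Z t)
    have h4 := mul_le_mul_of_nonneg_left h2 (norm_nonneg (A t))
    rw [e] at h4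
    linarith
  rw [intervalIntegral.integral_const_mul] at h1
  have := mul_le_mul_of_nonneg_left (hk x hx.1) (mul_nonneg (Real.exp_pos (k * x)).le hm0)
  linarith

theorem volterra_exists [CompleteSpace E] {A : ℝ → E →L[ℝ] E} (hA : Integrable A) {T : ℝ}
    (hT : 0 ≤ T) (Y₀ : E) :
    ∃ Y : ℝ → E, Continuous Y ∧ ∀ x ∈ Icc 0 T, Y x = Y₀ + ∫ t in (0:ℝ)..x, A t (Y t) := by
  obtain ⟨k, -, hk⟩ := exists_weight (fun t => ‖A t‖) hA.norm (fun t => norm_nonneg _)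
  let W (Z : C(Icc 0 T, E)) (t : ℝ) : E := Real.exp (k * t) • IccExtend hT Z t
  have hW (Z) : Continuous (W Z) := by
    have := Z.continuous.Icc_extend' (h := hT)
    fun_prop
  let P (Z : C(Icc 0 T, E)) (x : ℝ) : E := Y₀ + ∫ t in (0:ℝ)..x, A t (W Z t)
  have hP (Z) : Continuous (P Z) := continuous_const.add
    (intervalIntegral.continuous_primitive (fun a b => intervalIntegrable_apply hA (hW Z) a b) 0)
  let G (Z : C(Icc 0 T, E)) : C(Icc 0 T, E) :=
    ⟨fun x => Real.exp (-(k * x)) • P Z x, by have := hP Z; fun_prop⟩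
  have hG : ContractingWith (1 / 2) G := by
    refine ⟨by rw [← NNReal.coe_lt_coe]; norm_num, LipschitzWith.of_dist_le_mul fun Z Z' => ?_⟩
    rw [ContinuousMap.dist_le (by positivity)]
    intro x
    have hb := volterra_bound hA hk (Z := fun t => W Z t - W Z' t) (m := dist Z Z') (T := T)
      (fun t ht => ?_) x.2 dist_nonneg
    · rw [dist_eq_norm]
      simp only [G, P, ContinuousMap.coe_mk, ← smul_sub, add_sub_add_left_eq_sub]
      rw [← intervalIntegral.integral_sub (intervalIntegrable_apply hA (hW Z) _ _)
        (intervalIntegrable_apply hA (hW Z') _ _), norm_smul, Real.norm_eq_abs, Real.abs_exp]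
      simp only [map_sub] at hb
      have h2 := mul_le_mul_of_nonneg_left hb (Real.exp_pos (-(k * x))).le
      rw [← mul_assoc, ← Real.exp_add] at h2
      simp only [neg_add_cancel, Real.exp_zero, one_mul] at h2
      refine h2.trans (le_of_eq ?_)
      push_cast
      ring
    · simp only [W, ← smul_sub, norm_smul, Real.norm_eq_abs, Real.abs_exp]
      refine mul_le_mul_of_nonneg_left ?_ (Real.exp_pos _).le
      rw [← dist_eq_norm, IccExtend_of_mem _ _ ht, IccExtend_of_mem _ _ ht]
      exact ContinuousMap.dist_apply_le_dist _
  obtain ⟨Z, hZ⟩ : ∃ Z, G Z = Z := ⟨_, hG.fixedPoint_isFixedPt⟩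
  refine ⟨W Z, hW _, fun x hx => ?_⟩
  have h : Real.exp (-(k * x)) • P Z x = Z ⟨x, hx⟩ :=
    congrArg (fun Z : C(Icc 0 T, E) => Z ⟨x, hx⟩) hZ
  change W Z x = P Z x
  simp only [W]
  rw [IccExtend_of_mem _ _ hx, ← h, smul_smul, ← Real.exp_add]
  simp

theorem volterra_unique {A : ℝ → E →L[ℝ] E} (hA : Integrable A) {T : ℝ} {D : ℝ → E}
    (hc : ContinuousOn D (Icc 0 T)) (hD : ∀ x ∈ Icc 0 T, D x = ∫ t in (0:ℝ)..x, A t (D t)) :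
    ∀ x ∈ Icc 0 T, D x = 0 := by
  obtain ⟨k, -, hk⟩ := exists_weight (fun t => ‖A t‖) hA.norm (fun t => norm_nonneg _)
  intro x hx
  obtain ⟨z, hz, hmax⟩ := isCompact_Icc.exists_isMaxOn ⟨x, hx⟩
    (f := fun x => Real.exp (-(k * x)) * ‖D x‖)
    ((by fun_prop : Continuous fun x : ℝ => Real.exp (-(k * x))).continuousOn.mul hc.norm)
  have key (y : ℝ) : Real.exp (k * y) * Real.exp (-(k * y)) = 1 := by
    rw [← Real.exp_add]; simp
  set m := Real.exp (-(k * z)) * ‖D z‖ with hm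
  have hm0 : 0 ≤ m := by positivity
  have hb (y : ℝ) (hy : y ∈ Icc 0 T) : ‖D y‖ ≤ Real.exp (k * y) * m := by
    have h := mul_le_mul_of_nonneg_left (hmax hy) (Real.exp_pos (k * y)).le
    dsimp only at h
    rwa [← mul_assoc, key, one_mul] at h
  have h1 := volterra_bound hA hk hb hz hm0
  rw [← hD z hz] at h1
  have h2 := mul_le_mul_of_nonneg_left h1 (Real.exp_pos (-(k * z))).le
  rw [← mul_assoc, mul_comm (Real.exp (-(k * z))) (Real.exp (k * z)), key, one_mul] at h2
  have h3 : m = 0 := by linarith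
  have h4 := hb x hx
  rw [h3, mul_zero] at h4
  exact norm_le_zero_iff.mp h4

end volterra

theorem ac_primitive {f : ℝ → ℂ} (hf : ∀ a b, IntervalIntegrable f volume a b) (c : ℂ) (T : ℝ) :
    AbsolutelyContinuousOnInterval (fun x => c + ∫ t in (0:ℝ)..x, f t) 0 T := by
  have h : AbsolutelyContinuousOnInterval (fun x => ∫ t in (0:ℝ)..x, ‖f t‖) 0 T :=
    (hf 0 T).norm.absolutelyContinuousOnInterval_intervalIntegral left_mem_uIcc
  refine squeeze_zero (fun E => Finset.sum_nonneg fun _ _ => dist_nonneg) (fun E => ?_) h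
  refine Finset.sum_le_sum fun i _ => ?_
  rw [dist_comm, dist_comm (∫ t in (0:ℝ)..(E.2 i).1, ‖f t‖), dist_eq_norm, dist_eq_norm,
    add_sub_add_left_eq_sub,
    intervalIntegral.integral_interval_sub_left (hf _ _) (hf _ _),
    intervalIntegral.integral_interval_sub_left (hf _ _).norm (hf _ _).norm]
  exact intervalIntegral.norm_integral_le_abs_integral_norm

/-- The coefficient matrix of the first-order system for `(y, y^{[1]})`. -/
noncomputable def sysCoeff (σ : ℝ → ℂ) (lam : ℂ) (t : ℝ) : ℂ × ℂ →L[ℝ] ℂ × ℂ :=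
  σ t • (ContinuousLinearMap.fst ℝ ℂ ℂ).prod (-ContinuousLinearMap.snd ℝ ℂ ℂ) +
    -(σ t * σ t + lam) • (0 : ℂ × ℂ →L[ℝ] ℂ).prod (ContinuousLinearMap.fst ℝ ℂ ℂ) +
    (ContinuousLinearMap.snd ℝ ℂ ℂ).prod 0

/-- The coefficient matrix on `(0, T)`, extended by zero. -/
noncomputable def sysMat (T : ℝ) (σ : ℝ → ℂ) (lam : ℂ) : ℝ → ℂ × ℂ →L[ℝ] ℂ × ℂ :=
  (Ioo 0 T).indicator (sysCoeff σ lam)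

theorem sysMat_apply {T : ℝ} {σ : ℝ → ℂ} {lam : ℂ} {t : ℝ} (ht : t ∈ Ioo 0 T) (Y : ℂ × ℂ) :
    sysMat T σ lam t Y = (σ t * Y.1 + Y.2, -(σ t * σ t + lam) * Y.1 - σ t * Y.2) := by
  rw [sysMat, indicator_of_mem ht]
  exact Prod.ext (by simp [sysCoeff]) (by simp [sysCoeff]; ring)

theorem integrable_indicator_aux {F : Type} [NormedAddCommGroup F] [NormedSpace ℂ F] {T : ℝ}
    {f g : ℝ → ℂ} (hf : Integrable f (volume.restrict (Ioo 0 T)))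
    (hg : Integrable g (volume.restrict (Ioo 0 T))) (P Q R : F) :
    Integrable ((Ioo 0 T).indicator fun t => f t • P + g t • Q + R) := by
  refine IntegrableOn.integrable_indicator ?_ measurableSet_Ioo
  exact ((hf.smul_const P).add (hg.smul_const Q)).add (integrable_const R)

theorem sysMat_integrable {T : ℝ} {σ : ℝ → ℂ} (hσ : MemLp σ 2 (volume.restrict (Ioo 0 T)))
    (lam : ℂ) : Integrable (sysMat T σ lam) := by
  have h1 : Integrable σ (volume.restrict (Ioo 0 T)) := hσ.integrable one_le_two
  have h2 : Integrable (fun t => σ t * σ t) (volume.restrict (Ioo 0 T)) := hσ.integrable_mul hσ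
  exact integrable_indicator_aux h1 (h2.add (integrable_const lam)).neg _ _ _

theorem exists_solution {T : ℝ} (hT : 0 < T) {σ : ℝ → ℂ}
    (hσ : MemLp σ 2 (volume.restrict (Ioo 0 T))) (lam a b : ℂ) :
    ∃ p : (ℝ → ℂ) × (ℝ → ℂ), IsSolution T σ lam p.1 p.2 ∧ p.1 0 = a ∧ p.2 0 = b := by
  have hA := sysMat_integrable hσ lam
  obtain ⟨Y, hY, hYe⟩ := volterra_exists hA hT.le (a, b)
  have hI := intervalIntegrable_apply hA hY
  have hI1 (u v : ℝ) : IntervalIntegrable (fun t => (sysMat T σ lam t (Y t)).1) volume u v :=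
    ⟨(hI u v).1.fst, (hI u v).2.fst⟩
  have hI2 (u v : ℝ) : IntervalIntegrable (fun t => (sysMat T σ lam t (Y t)).2) volume u v :=
    ⟨(hI u v).1.snd, (hI u v).2.snd⟩
  have e (x : ℝ) (hx : x ∈ Icc 0 T) :
      Y x = (a + ∫ t in (0:ℝ)..x, (sysMat T σ lam t (Y t)).1,
        b + ∫ t in (0:ℝ)..x, (sysMat T σ lam t (Y t)).2) := by
    conv_lhs => rw [hYe x hx]
    simp only [intervalIntegral.integral_of_le hx.1]
    refine Prod.ext ?_ ?_
    · rw [Prod.fst_add, fst_integral (hI 0 x).1]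
    · rw [Prod.snd_add, snd_integral (hI 0 x).1]
  have d1 := (hI1 0 T).ae_hasDerivAt_integral
  have d2 := (hI2 0 T).ae_hasDerivAt_integral
  refine ⟨(fun x => a + ∫ t in (0:ℝ)..x, (sysMat T σ lam t (Y t)).1,
    fun x => b + ∫ t in (0:ℝ)..x, (sysMat T σ lam t (Y t)).2),
    ⟨ac_primitive hI1 a T, ac_primitive hI2 b T, ?_, ?_⟩, by simp, by simp⟩
  · filter_upwards [ae_restrict_of_ae d1, ae_restrict_mem measurableSet_Ioo] with x hx hm
    have hm' : x ∈ Icc 0 T := Ioo_subset_Icc_self hm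
    rw [uIcc_of_le hT.le] at hx
    refine ⟨_, (hx hm' 0 ⟨le_rfl, hT.le⟩).const_add a, ?_⟩
    have h := e x hm'
    rw [sysMat_apply hm, h]
    simp
  · filter_upwards [ae_restrict_of_ae d2, ae_restrict_mem measurableSet_Ioo] with x hx hm
    have hm' : x ∈ Icc 0 T := Ioo_subset_Icc_self hm
    rw [uIcc_of_le hT.le] at hx
    refine ⟨_, (hx hm' 0 ⟨le_rfl, hT.le⟩).const_add b, ?_⟩
    have h := e x hm'
    rw [sysMat_apply hm, h]
    ring

theorem IsSolution.sub {T : ℝ} {σ : ℝ → ℂ} {lam : ℂ} {y y₁ z z₁ : ℝ → ℂ}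
    (h : IsSolution T σ lam y y₁) (h' : IsSolution T σ lam z z₁) :
    IsSolution T σ lam (y - z) (y₁ - z₁) := by
  refine ⟨h.ac.sub h'.ac, h.ac_quasi.sub h'.ac_quasi, ?_, ?_⟩
  · filter_upwards [h.quasi, h'.quasi] with x ⟨d, hd, e⟩ ⟨d', hd', e'⟩
    exact ⟨_, hd.sub hd', by simp only [Pi.sub_apply, e, e']; ring⟩
  · filter_upwards [h.eqn, h'.eqn] with x ⟨d, hd, e⟩ ⟨d', hd', e'⟩
    refine ⟨_, hd.sub hd', ?_⟩
    simp only [Pi.sub_apply]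
    linear_combination e - e'

theorem eq_primitive {T : ℝ} (hT : 0 < T) {f f' : ℝ → ℂ} (hf : AbsolutelyContinuousOnInterval f 0 T)
    (hI : ∀ a b, IntervalIntegrable f' volume a b)
    (hd : ∀ᵐ x ∂volume.restrict (Ioo 0 T), HasDerivAt f (f' x) x) {x : ℝ} (hx : x ∈ Icc 0 T) :
    f x = f 0 + ∫ t in (0:ℝ)..x, f' t := by
  have hac := hf.sub (ac_primitive hI 0 T)
  have h0 : ∀ᵐ x, x ∈ uIcc 0 T → HasDerivAt (f - fun x => 0 + ∫ t in (0:ℝ)..x, f' t) 0 x := by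
    have n0 : ∀ᵐ x : ℝ, x ≠ 0 := by simp [ae_iff]
    have nT : ∀ᵐ x : ℝ, x ≠ T := by simp [ae_iff]
    filter_upwards [(ae_restrict_iff' measurableSet_Ioo).1 hd, (hI 0 T).ae_hasDerivAt_integral,
      n0, nT] with x h1 h2 h3 h4 hm
    have hm' := hm
    rw [uIcc_of_le hT.le] at hm'
    have := (h1 ⟨lt_of_le_of_ne hm'.1 h3.symm, lt_of_le_of_ne hm'.2 h4⟩).sub
      ((h2 hm 0 left_mem_uIcc).const_add 0)
    simpa using this
  obtain ⟨C, hC⟩ := hac.const_of_ae_hasDerivAt_zero h0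
  have e0 := hC 0 left_mem_uIcc
  have ex := hC x (by rwa [uIcc_of_le hT.le])
  simp only [Pi.sub_apply, intervalIntegral.integral_same, zero_add, sub_zero] at e0 ex
  rw [e0, ← ex]
  ring

theorem solution_unique {T : ℝ} (hT : 0 < T) {σ : ℝ → ℂ}
    (hσ : MemLp σ 2 (volume.restrict (Ioo 0 T))) {lam : ℂ} {y y₁ z z₁ : ℝ → ℂ}
    (h : IsSolution T σ lam y y₁) (h' : IsSolution T σ lam z z₁) (h0 : y 0 = z 0)
    (h0' : y₁ 0 = z₁ 0) : ∀ x ∈ Icc 0 T, y x = z x ∧ y₁ x = z₁ x := by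
  have hs := h.sub h'
  set u := y - z with hu
  set v := y₁ - z₁ with hv
  have hA := sysMat_integrable hσ lam
  have c1 := hs.ac.continuousOn
  have c2 := hs.ac_quasi.continuousOn
  rw [uIcc_of_le hT.le] at c1 c2
  have hc : ContinuousOn (fun x => (u x, v x)) (Icc 0 T) := c1.prodMk c2
  let D : ℝ → ℂ × ℂ := IccExtend hT.le ((Icc 0 T).domRestrict fun x => (u x, v x))
  have hDc : Continuous D := (continuousOn_iff_continuous_domRestrict.1 hc).Icc_extend'
  have hDe (x : ℝ) (hx : x ∈ Icc 0 T) : D x = (u x, v x) := by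
    simp only [D]; rw [IccExtend_of_mem _ _ hx]; rfl
  have hI := intervalIntegrable_apply hA hDc
  have hI1 (u v : ℝ) : IntervalIntegrable (fun t => (sysMat T σ lam t (D t)).1) volume u v :=
    ⟨(hI u v).1.fst, (hI u v).2.fst⟩
  have hI2 (u v : ℝ) : IntervalIntegrable (fun t => (sysMat T σ lam t (D t)).2) volume u v :=
    ⟨(hI u v).1.snd, (hI u v).2.snd⟩
  have key : ∀ x ∈ Icc 0 T, D x = ∫ t in (0:ℝ)..x, sysMat T σ lam t (D t) := by
    intro x hx
    rw [hDe x hx]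
    have e1 := eq_primitive hT hs.ac hI1 (by
      filter_upwards [hs.quasi, ae_restrict_mem measurableSet_Ioo] with t ⟨d, hd, e⟩ hm
      rw [sysMat_apply hm, hDe t (Ioo_subset_Icc_self hm)]
      convert! hd using 1
      rw [e]; ring) hx
    have e2 := eq_primitive hT hs.ac_quasi hI2 (by
      filter_upwards [hs.eqn, ae_restrict_mem measurableSet_Ioo] with t ⟨d, hd, e⟩ hm
      rw [sysMat_apply hm, hDe t (Ioo_subset_Icc_self hm)]
      convert! hd using 1
      linear_combination e) hx
    have u0 : u 0 = 0 := by simp [hu, h0]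
    have v0 : v 0 = 0 := by simp [hv, h0']
    rw [u0, zero_add] at e1
    rw [v0, zero_add] at e2
    simp only [intervalIntegral.integral_of_le hx.1] at e1 e2 ⊢
    refine Prod.ext ?_ ?_
    · rw [fst_integral (hI 0 x).1]; exact e1
    · rw [snd_integral (hI 0 x).1]; exact e2
  intro x hx
  have h1 := volterra_unique hA hDc.continuousOn key x hx
  rw [hDe x hx, Prod.mk_eq_zero] at h1
  exact ⟨sub_eq_zero.1 h1.1, sub_eq_zero.1 h1.2⟩

/-- The pair `(y, y^{[1]})` on `[0, T]` with the initial values `y(0) = a`, `y^{[1]}(0) = b`. -/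
noncomputable def cauchySol (T : ℝ) (σ : ℝ → ℂ) (lam a b : ℂ) : (ℝ → ℂ) × (ℝ → ℂ) :=
  Classical.epsilon fun p => IsSolution T σ lam p.1 p.2 ∧ p.1 0 = a ∧ p.2 0 = b

theorem cauchySol_spec {T : ℝ} (hT : 0 < T) {σ : ℝ → ℂ}
    (hσ : MemLp σ 2 (volume.restrict (Ioo 0 T))) (lam a b : ℂ) :
    IsSolution T σ lam (cauchySol T σ lam a b).1 (cauchySol T σ lam a b).2 ∧
      (cauchySol T σ lam a b).1 0 = a ∧ (cauchySol T σ lam a b).2 0 = b :=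
  Classical.epsilon_spec (exists_solution hT hσ lam a b)

theorem cauchySol_eq {T : ℝ} (hT : 0 < T) {σ : ℝ → ℂ}
    (hσ : MemLp σ 2 (volume.restrict (Ioo 0 T))) {lam : ℂ} {y y₁ : ℝ → ℂ}
    (h : IsSolution T σ lam y y₁) {x : ℝ} (hx : x ∈ Icc 0 T) :
    y x = (cauchySol T σ lam (y 0) (y₁ 0)).1 x ∧ y₁ x = (cauchySol T σ lam (y 0) (y₁ 0)).2 x := by
  obtain ⟨h1, h2, h3⟩ := cauchySol_spec hT hσ lam (y 0) (y₁ 0)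
  exact solution_unique hT hσ h h1 h2.symm h3.symm x hx

/-- `φ(x, lam)`: the solution with `φ(0) = 1`, `φ^{[1]}(0) = 0`. -/
noncomputable def phi (T : ℝ) (σ : ℝ → ℂ) (x : ℝ) (lam : ℂ) : ℂ := (cauchySol T σ lam 1 0).1 x

/-- `φ^{[1]}(x, lam)`. -/
noncomputable def phiQuasi (T : ℝ) (σ : ℝ → ℂ) (x : ℝ) (lam : ℂ) : ℂ := (cauchySol T σ lam 1 0).2 x

/-- `S(x, lam)`: the solution with `S(0) = 0`, `S^{[1]}(0) = 1`. -/
noncomputable def sol (T : ℝ) (σ : ℝ → ℂ) (x : ℝ) (lam : ℂ) : ℂ := (cauchySol T σ lam 0 1).1 x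

/-- `S^{[1]}(x, lam)`. -/
noncomputable def solQuasi (T : ℝ) (σ : ℝ → ℂ) (x : ℝ) (lam : ℂ) : ℂ := (cauchySol T σ lam 0 1).2 x

/-- `c(x) = φ^{[1]}(x, 0)`. -/
noncomputable def cFun (T : ℝ) (σ : ℝ → ℂ) (x : ℝ) : ℂ := phiQuasi T σ x 0

/-- The function `η` in `φ^{[1]}(x, ρ²) = -ρ sin(ρ x) + ρ η(x, ρ) + c(x)`. Its continuous value at
`ρ = 0` is `0`, because the numerator below is an even entire function of `ρ` vanishing at `0`;
this agrees with division by zero here. -/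
noncomputable def eta (T : ℝ) (σ : ℝ → ℂ) (x : ℝ) (ρ : ℂ) : ℂ :=
  (phiQuasi T σ x (ρ ^ 2) + ρ * Complex.sin (ρ * x) - cFun T σ x) / ρ

/-- The norm of `L²(0, x)`. -/
noncomputable def normOn (x : ℝ) (f : ℝ → ℂ) : ℝ≥0∞ := eLpNorm f 2 (volume.restrict (Ioo 0 x))

/-- The class `L²(0, x)`. -/
def InL2 (x : ℝ) (f : ℝ → ℂ) : Prop := MemLp f 2 (volume.restrict (Ioo 0 x))

/-- `f` belongs to `L²(ℝ)` and its norm, increased by `a`, is at most `B`. -/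
def L2LineBound (f : ℝ → ℂ) (a B : ℝ≥0∞) : Prop := MemLp f 2 volume ∧ eLpNorm f 2 volume + a ≤ B

/-- `K` and `N` are the transformation kernels `𝒦(x, ·)` and `𝒩(x, ·)`: functions of `L²(0, x)` with
`φ(x, ρ²) = cos ρx + ∫₀ˣ 𝒦(x, t) cos ρt dt` and
`φ^{[1]}(x, ρ²) = -ρ sin ρx + ρ ∫₀ˣ 𝒩(x, t) sin ρt dt + c(x)` for all complex `ρ`. These relations
determine both kernels almost everywhere on `(0, x)`. -/
structure IsTransformationPair (T : ℝ) (σ : ℝ → ℂ) (x : ℝ) (K N : ℝ → ℂ) : Prop where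
  memLp_left : InL2 x K
  memLp_right : InL2 x N
  phi_eq : ∀ ρ : ℂ, phi T σ x (ρ ^ 2) =
    Complex.cos (ρ * x) + ∫ t in (0 : ℝ)..x, K t * Complex.cos (ρ * t)
  phiQuasi_eq : ∀ ρ : ℂ, phiQuasi T σ x (ρ ^ 2) =
    -ρ * Complex.sin (ρ * x) + ρ * (∫ t in (0 : ℝ)..x, N t * Complex.sin (ρ * t)) + cFun T σ x

end SturmLiouville

open SturmLiouville

/-! Both fundamental solutions fit one first-order system `y' = σy + ρv + c`, `v' = -ρy - σv - σ²u`,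
`u' = σu + v` with `u(0) = 0` (`IsModSol`). For `S` take `y = ρS`, `v = S^{[1]}`, `u = S`, `c = 0`.
For `φ` subtract the solution at `λ = 0`: `v = (φ^{[1]} - c)/ρ`, `u = (φ - φ(·,0))/ρ`, with `c` as
forcing term. In the variables `p = exp(-iρx)(y - iv)`, `q = exp(iρx)(y + iv)`, `u`, the parameter
`ρ` survives only in factors `exp(iρa)` with real `a` (`IsModSol.isScal`).

Under `f ↦ ∫ f(s) exp(iρs) ds` such a factor is a translation by `a`, an isometry of `L²(ℝ)`. Hence
one looks for `p`, `q`, `u` as their initial values plus transforms of `L²(ℝ)`-valued curves, which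
solve a Volterra equation free of `ρ` (`kerOp`, `kerSrc`). Its coefficients are dominated by the
integrable function `|σ| + |σ|² + 1`. Its source terms are dilates of `σ`, `c` and an indicator
function, hence lie in `L²`. Since `u(0) = 0`, the function `σ²`, which is only in `L¹`, never
occurs as a source but only as a coefficient.

The Volterra equation is solved by contraction among curves with support growing linearly in `x`
(`exists_isKernel`). The transform of its solution satisfies the scalar equation for every complex
`ρ`, and uniqueness there identifies it with the differential equation (`IsModSol.representation`).
Gronwall's inequality makes the kernels locally Lipschitz in `σ`, with a constant depending only on
`Ω` and `T` (`IsKernel.norm_sub_le`). Plancherel (`fhat_memLp`) turns this into `L²` bounds in real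
`ρ`, and evenness or oddness in `ρ` folds the kernels from `(-x, x)` to `(0, x)`, which gives `𝒦`
and `𝒩` (`isTransformationPair`). -/

namespace SturmLiouville

/-! ### Volterra equations in a Banach space, with explicit constants. -/

/-- The weight `exp (2 ∫₀ˣ a)`. -/
noncomputable def growth (a : ℝ → ℝ) (x : ℝ) : ℝ := Real.exp (2 * ∫ t in (0:ℝ)..x, a t)

theorem growth_pos (a : ℝ → ℝ) (x : ℝ) : 0 < growth a x := Real.exp_pos _

theorem growth_continuous {a : ℝ → ℝ} (ha : Integrable a) : Continuous (growth a) :=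
  Real.continuous_exp.comp (continuous_const.mul
    (intervalIntegral.continuous_primitive (fun _ _ => ha.intervalIntegrable) 0))

theorem growth_mono {a : ℝ → ℝ} (ha : Integrable a) (h0 : ∀ t, 0 ≤ a t) : Monotone (growth a) := by
  intro x y hxy
  refine Real.exp_le_exp.2 (mul_le_mul_of_nonneg_left ?_ zero_le_two)
  have h1 : IntervalIntegrable a volume 0 x := ha.intervalIntegrable
  have h2 : IntervalIntegrable a volume x y := ha.intervalIntegrable
  rw [← intervalIntegral.integral_add_adjacent_intervals h1 h2]
  exact le_add_of_nonneg_right (intervalIntegral.integral_nonneg hxy fun t _ => h0 t)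

theorem one_le_growth {a : ℝ → ℝ} (h0 : ∀ t, 0 ≤ a t) {x : ℝ} (hx : 0 ≤ x) : 1 ≤ growth a x :=
  Real.one_le_exp (mul_nonneg zero_le_two (intervalIntegral.integral_nonneg hx fun t _ => h0 t))

/-- The weight has almost everywhere the derivative `2a` times itself; the factor `2` in its
exponent produces the contraction constant `1/2`. Unlike a weight `exp(kx)` with `k` depending on
the shape of `a`, this one is controlled by `∫ a` alone, which makes the final constants uniform in
`σ`. -/
theorem integral_mul_growth_le {a : ℝ → ℝ} (ha : Integrable a) (h0 : ∀ t, 0 ≤ a t) {x : ℝ}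
    (hx : 0 ≤ x) : ∫ t in (0:ℝ)..x, a t * growth a t ≤ growth a x / 2 := by
  have hI : IntervalIntegrable a volume 0 x := ha.intervalIntegrable
  have hm : MonotoneOn (growth a) (uIcc 0 x) := (growth_mono ha h0).monotoneOn _
  -- For a monotone function the integral of the derivative is at most the increment; this is all
  -- that is needed, so absolute continuity of the weight is not used.
  have h1 := hm.intervalIntegral_deriv_mem_uIcc
  have h2 : ∫ t in (0:ℝ)..x, deriv (growth a) t = ∫ t in (0:ℝ)..x, 2 * (a t * growth a t) := by
    refine intervalIntegral.integral_congr_ae ?_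
    filter_upwards [hI.ae_hasDerivAt_integral] with t ht hm
    have := (ht (uIoc_subset_uIcc hm) 0 left_mem_uIcc).const_mul 2 |>.exp
    rw [show growth a = fun x => Real.exp (2 * ∫ t in (0:ℝ)..x, a t) from rfl, this.deriv]
    ring
  have h3 := growth_mono ha h0 hx
  rw [h2, intervalIntegral.integral_const_mul, uIcc_of_le (by linarith)] at h1
  have := h1.2
  have := growth_pos a 0
  linarith

section
variable {E : Type*} [NormedAddCommGroup E] [NormedSpace ℝ E]

/-- A measurable family of additive operators dominated by an integrable function. -/
structure IsVolterra (a : ℝ → ℝ) (B : ℝ → E → E) : Prop where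
  integrable : Integrable a
  nonneg : ∀ t, 0 ≤ a t
  map_sub : ∀ t u v, B t (u - v) = B t u - B t v
  norm_le : ∀ t u, ‖B t u‖ ≤ a t * ‖u‖
  meas : ∀ Z : ℝ → E, Continuous Z → AEStronglyMeasurable (fun t => B t (Z t))

theorem IsVolterra.intervalIntegrable {a : ℝ → ℝ} {B : ℝ → E → E} (h : IsVolterra a B) {Y : ℝ → E}
    (hY : Continuous Y) (u v : ℝ) : IntervalIntegrable (fun t => B t (Y t)) volume u v := by
  obtain ⟨M, hM⟩ := (isCompact_uIcc (a := u) (b := v)).exists_bound_of_continuousOn hY.continuousOn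
  refine (h.integrable.intervalIntegrable.mul_const M).mono_fun (h.meas Y hY).restrict ?_
  refine (ae_restrict_mem measurableSet_uIoc).mono fun t ht => ?_
  exact ((h.norm_le t _).trans (mul_le_mul_of_nonneg_left (hM t (uIoc_subset_uIcc ht))
    (h.nonneg t))).trans (le_abs_self _)

/-- In the supremum norm weighted by `1 / growth a`, Volterra integration halves the norm. This
serves both existence and Gronwall's inequality. -/
theorem growth_volterra_bound {a : ℝ → ℝ} (ha : Integrable a) (h0 : ∀ t, 0 ≤ a t) {g : ℝ → E}
    {r : ℝ → ℝ} {m x : ℝ} (hx : 0 ≤ x) (hm : ∀ t ∈ Icc 0 x, r t ≤ growth a t * m)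
    (hg : ∀ t ∈ Icc 0 x, ‖g t‖ ≤ a t * r t) (hm0 : 0 ≤ m) :
    ‖∫ t in (0:ℝ)..x, g t‖ ≤ growth a x * (m / 2) := by
  have hI : IntervalIntegrable (fun t => a t * growth a t) volume 0 x :=
    ha.intervalIntegrable.mul_continuousOn (growth_continuous ha).continuousOn
  have h1 : ‖∫ t in (0:ℝ)..x, g t‖ ≤ ∫ t in (0:ℝ)..x, m * (a t * growth a t) := by
    apply intervalIntegral.norm_integral_le_of_norm_le hx _ (hI.const_mul _)
    refine Eventually.of_forall fun t ht => ?_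
    have ht' : t ∈ Icc 0 x := ⟨ht.1.le, ht.2⟩
    have := mul_le_mul_of_nonneg_left (hm t ht') (h0 t)
    linarith [hg t ht']
  rw [intervalIntegral.integral_const_mul] at h1
  have := mul_le_mul_of_nonneg_left (integral_mul_growth_le ha h0 hx) hm0
  linarith

theorem volterra_gronwall {a : ℝ → ℝ} (ha : Integrable a) (h0 : ∀ t, 0 ≤ a t) {D g : ℝ → E}
    {m x : ℝ} (hm0 : 0 ≤ m) (hD : ContinuousOn D (Icc 0 x)) (hg : ∀ t ∈ Icc 0 x, ‖g t‖ ≤ a t * ‖D t‖)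
    (h : ∀ t ∈ Icc 0 x, ‖D t - ∫ s in (0:ℝ)..t, g s‖ ≤ m) :
    ∀ t ∈ Icc 0 x, ‖D t‖ ≤ growth a t * (2 * m) := by
  intro t ht
  have hc := (growth_continuous ha)
  obtain ⟨z, hz, hmax⟩ := isCompact_Icc.exists_isMaxOn ⟨t, ht⟩
    (f := fun x => (growth a x)⁻¹ * ‖D x‖)
    ((hc.inv₀ fun x => (growth_pos a x).ne').continuousOn.mul hD.norm)
  set M := (growth a z)⁻¹ * ‖D z‖ with hM
  have hM0 : 0 ≤ M := mul_nonneg (inv_nonneg.2 (growth_pos a z).le) (norm_nonneg _)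
  have hb (y : ℝ) (hy : y ∈ Icc 0 x) : ‖D y‖ ≤ growth a y * M := by
    have h := mul_le_mul_of_nonneg_left (hmax hy) (growth_pos a y).le
    dsimp only at h
    rwa [← mul_assoc, mul_inv_cancel₀ (growth_pos a y).ne', one_mul] at h
  have h1 := growth_volterra_bound ha h0 hz.1 (r := fun t => ‖D t‖) (g := g)
    (fun t ht => hb t ⟨ht.1, ht.2.trans hz.2⟩) (fun t ht => hg t ⟨ht.1, ht.2.trans hz.2⟩) hM0
  have h2 : ‖D z‖ ≤ growth a z * (M / 2) + m := by
    have := norm_sub_norm_le (D z) (∫ s in (0:ℝ)..z, g s)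
    linarith [h z hz]
  have h3 : ‖D z‖ = growth a z * M := by
    rw [hM, ← mul_assoc, mul_inv_cancel₀ (growth_pos a z).ne', one_mul]
  have h4 := one_le_growth h0 hz.1
  -- At the maximum point `growth a z * M ≤ growth a z * (M / 2) + m`, and the weight is at least
  -- `1` there.
  have h5 : M ≤ 2 * m := by
    by_contra hlt
    push Not at hlt
    nlinarith
  exact (hb t ht).trans (mul_le_mul_of_nonneg_left h5 (growth_pos a t).le)

/-- The subspaces `V x` carry the support information: if the integral equation preserves them, the
fixed point can be sought in the closed set of curves that respect them. -/
theorem IsVolterra.exists_solution [CompleteSpace E] {a : ℝ → ℝ} {B : ℝ → E → E}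
    (h : IsVolterra a B) {T : ℝ} (hT : 0 ≤ T) {F : ℝ → E} (hF : Continuous F)
    (V : ℝ → Submodule ℝ E) (hV : ∀ x, IsClosed (V x : Set E))
    (hmem : ∀ Z : ℝ → E, Continuous Z → (∀ x ∈ Icc 0 T, Z x ∈ V x) → ∀ x ∈ Icc 0 T,
      F x + ∫ t in (0:ℝ)..x, B t (Z t) ∈ V x) :
    ∃ Y : ℝ → E, Continuous Y ∧ (∀ x ∈ Icc 0 T, Y x = F x + ∫ t in (0:ℝ)..x, B t (Y t)) ∧
      ∀ x ∈ Icc 0 T, Y x ∈ V x := by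
  have hgc := growth_continuous h.integrable
  have hg0 (x : ℝ) : growth a x ≠ 0 := (growth_pos a x).ne'
  let W (Z : C(Icc 0 T, E)) (t : ℝ) : E := growth a t • IccExtend hT Z t
  have hW (Z) : Continuous (W Z) := by
    have := Z.continuous.Icc_extend' (h := hT)
    fun_prop
  let P (Z : C(Icc 0 T, E)) (x : ℝ) : E := F x + ∫ t in (0:ℝ)..x, B t (W Z t)
  have hP (Z) : Continuous (P Z) := hF.add
    (intervalIntegral.continuous_primitive (fun a b => h.intervalIntegrable (hW Z) a b) 0)
  let G (Z : C(Icc 0 T, E)) : C(Icc 0 T, E) :=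
    ⟨fun x => (growth a x)⁻¹ • P Z x,
      ((hgc.inv₀ hg0).comp continuous_subtype_val).smul ((hP Z).comp continuous_subtype_val)⟩
  have hG : ContractingWith (1 / 2) G := by
    refine ⟨by rw [← NNReal.coe_lt_coe]; norm_num, LipschitzWith.of_dist_le_mul fun Z Z' => ?_⟩
    rw [ContinuousMap.dist_le (by positivity)]
    intro x
    have hb := growth_volterra_bound h.integrable h.nonneg x.2.1 (m := dist Z Z')
      (r := fun t => ‖W Z t - W Z' t‖) (g := fun t => B t (W Z t - W Z' t))
      (fun t ht => ?_) (fun t _ => h.norm_le t _) dist_nonneg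
    · rw [dist_eq_norm]
      simp only [G, P, ContinuousMap.coe_mk, ← smul_sub, add_sub_add_left_eq_sub]
      rw [← intervalIntegral.integral_sub (h.intervalIntegrable (hW Z) _ _)
        (h.intervalIntegrable (hW Z') _ _), norm_smul, norm_inv, Real.norm_eq_abs,
        abs_of_pos (growth_pos a x)]
      simp only [h.map_sub] at hb
      have h2 := mul_le_mul_of_nonneg_left hb (inv_nonneg.2 (growth_pos a x).le)
      rw [← mul_assoc, inv_mul_cancel₀ (hg0 x), one_mul] at h2
      refine h2.trans (le_of_eq ?_)
      push_cast
      ring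
    · have ht' : t ∈ Icc 0 T := ⟨ht.1, ht.2.trans x.2.2⟩
      simp only [W, ← smul_sub, norm_smul, Real.norm_eq_abs, abs_of_pos (growth_pos a t)]
      refine mul_le_mul_of_nonneg_left ?_ (growth_pos a t).le
      rw [← dist_eq_norm, IccExtend_of_mem _ _ ht', IccExtend_of_mem _ _ ht']
      exact ContinuousMap.dist_apply_le_dist _
  let s : Set C(Icc 0 T, E) := {Z | ∀ x : Icc 0 T, Z x ∈ V x}
  have hs : IsClosed s := by
    have : s = ⋂ x : Icc 0 T, (fun Z : C(Icc 0 T, E) => Z x) ⁻¹' (V x : Set E) := by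
      ext Z; simp [s]
    rw [this]
    exact isClosed_iInter fun x => (hV x).preimage (continuous_eval_const x)
  have hGs : MapsTo G s s := by
    intro Z hZ x
    refine (V x).smul_mem _ (hmem (W Z) (hW Z) (fun t ht => ?_) x x.2)
    simp only [W]
    rw [IccExtend_of_mem _ _ ht]
    exact (V t).smul_mem _ (hZ ⟨t, ht⟩)
  -- Banach's theorem in the closed invariant set `s`, started at the zero curve, which lies in
  -- every `V x`.
  obtain ⟨Z, hZs, hZ, -, -⟩ := (hG.restrict hGs).exists_fixedPoint' hs.isComplete hGs
    (x := (0 : C(Icc 0 T, E))) (fun x => (V x).zero_mem) (edist_ne_top _ _)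
  have key (x : ℝ) (hx : x ∈ Icc 0 T) : W Z x = P Z x := by
    have h : (growth a x)⁻¹ • P Z x = Z ⟨x, hx⟩ :=
      congrArg (fun Z : C(Icc 0 T, E) => Z ⟨x, hx⟩) hZ
    simp only [W]
    rw [IccExtend_of_mem _ _ hx, ← h, smul_smul, mul_inv_cancel₀ (hg0 x), one_smul]
  refine ⟨W Z, hW _, key, fun x hx => ?_⟩
  simp only [W]
  rw [IccExtend_of_mem _ _ hx]
  exact (V x).smul_mem _ (hZs ⟨x, hx⟩)

theorem IsVolterra.norm_le_growth {a : ℝ → ℝ} {B : ℝ → E → E}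
    (h : IsVolterra a B) {F Y : ℝ → E} {x f : ℝ} (hf : 0 ≤ f) (hY : Continuous Y)
    (hF : ∀ t ∈ Icc 0 x, ‖F t‖ ≤ f)
    (hYe : ∀ t ∈ Icc 0 x, Y t = F t + ∫ s in (0:ℝ)..t, B s (Y s)) :
    ∀ t ∈ Icc 0 x, ‖Y t‖ ≤ growth a t * (2 * f) := by
  refine volterra_gronwall h.integrable h.nonneg hf hY.continuousOn
    (g := fun t => B t (Y t)) (fun t _ => h.norm_le t _) fun t ht => ?_
  rw [sub_eq_of_eq_add (hYe t ht)]
  exact hF t ht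

/-- The difference solves the Volterra equation of `B` with source `(F - F') + ∫ (B - B') Y'`;
Gronwall's inequality applies, given an a priori bound on `Y'` alone. -/
theorem IsVolterra.norm_sub_le {a a' b : ℝ → ℝ} {B B' : ℝ → E → E}
    (h : IsVolterra a B) (h' : IsVolterra a' B') (hb : Integrable b)
    (hb0 : ∀ t, 0 ≤ b t) (hBB : ∀ t u, ‖B t u - B' t u‖ ≤ b t * ‖u‖)
    {F F' Y Y' : ℝ → E} {x f M : ℝ} (hf : 0 ≤ f) (hM : 0 ≤ M)
    (hY : Continuous Y) (hY' : Continuous Y')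
    (hF : ∀ t ∈ Icc 0 x, ‖F t - F' t‖ ≤ f) (hYM : ∀ t ∈ Icc 0 x, ‖Y' t‖ ≤ M)
    (hYe : ∀ t ∈ Icc 0 x, Y t = F t + ∫ s in (0:ℝ)..t, B s (Y s))
    (hYe' : ∀ t ∈ Icc 0 x, Y' t = F' t + ∫ s in (0:ℝ)..t, B' s (Y' s)) :
    ∀ t ∈ Icc 0 x, ‖Y t - Y' t‖ ≤ growth a t * (2 * (f + M * ∫ s in (0:ℝ)..x, b s)) := by
  intro t ht
  have hx : 0 ≤ x := ht.1.trans ht.2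
  have hI0 : 0 ≤ ∫ s in (0:ℝ)..x, b s := intervalIntegral.integral_nonneg hx fun s _ => hb0 s
  refine volterra_gronwall h.integrable h.nonneg (D := fun t => Y t - Y' t)
    (g := fun t => B t (Y t - Y' t)) (x := x) (by positivity) (hY.sub hY').continuousOn
    (fun t _ => h.norm_le t _) (fun t ht => ?_) t ht
  have i1 := h.intervalIntegrable hY 0 t
  have i2 := h'.intervalIntegrable hY' 0 t
  have i3 := h.intervalIntegrable hY' 0 t
  have e : Y t - Y' t - ∫ s in (0:ℝ)..t, B s (Y s - Y' s) =
      (F t - F' t) + ∫ s in (0:ℝ)..t, (B s (Y' s) - B' s (Y' s)) := by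
    simp only [h.map_sub]
    rw [intervalIntegral.integral_sub i1 i3, intervalIntegral.integral_sub i3 i2, hYe t ht,
      hYe' t ht]
    abel
  rw [e]
  refine (norm_add_le _ _).trans (add_le_add (hF t ht) ?_)
  have h1 : ‖∫ s in (0:ℝ)..t, (B s (Y' s) - B' s (Y' s))‖ ≤ ∫ s in (0:ℝ)..t, M * b s := by
    apply intervalIntegral.norm_integral_le_of_norm_le ht.1 _ (hb.intervalIntegrable.const_mul _)
    refine Eventually.of_forall fun s hs => ?_
    have := mul_le_mul_of_nonneg_left (hYM s ⟨hs.1.le, hs.2.trans ht.2⟩) (hb0 s)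
    linarith [hBB s (Y' s)]
  rw [intervalIntegral.integral_const_mul] at h1
  refine h1.trans (mul_le_mul_of_nonneg_left ?_ hM)
  have j1 : IntervalIntegrable b volume 0 t := hb.intervalIntegrable
  have j2 : IntervalIntegrable b volume t x := hb.intervalIntegrable
  rw [← intervalIntegral.integral_add_adjacent_intervals j1 j2]
  exact le_add_of_nonneg_right (intervalIntegral.integral_nonneg ht.2 fun t _ => hb0 t)

end

/-! ### Translations, supports and the exponential transform on `L²(ℝ)`. -/

/-- `L²(ℝ)`. -/
abbrev LineL2 : Type := Lp ℂ 2 (volume : Measure ℝ)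

/-- Translation by `a` on `L²(ℝ)`. -/
noncomputable def trans (a : ℝ) : LineL2 →ₗᵢ[ℂ] LineL2 :=
  Lp.compMeasurePreservingₗᵢ ℂ (fun s => s - a) (measurePreserving_sub_right volume a)

theorem trans_ae (a : ℝ) (f : LineL2) : trans a f =ᵐ[volume] fun s => f (s - a) :=
  Lp.coeFn_compMeasurePreserving f (measurePreserving_sub_right volume a)

/-- Translations depend on the shift continuously only in the strong sense, not in operator norm.
Joint continuity in shift and function is what yields the field `meas` of `IsVolterra`, which for
this reason concerns `B t (Z t)` and not an operator-valued map. -/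
theorem continuous_trans {X : Type*} [TopologicalSpace X] {a : X → ℝ} {f : X → LineL2}
    (ha : Continuous a) (hf : Continuous f) : Continuous fun z => trans (a z) (f z) := by
  have hc : Continuous fun z => (⟨fun s => s - a z, by fun_prop⟩ : C(ℝ, ℝ)) :=
    ContinuousMap.continuous_of_continuous_uncurry _ (by
      simp only [Function.uncurry_def, ContinuousMap.coe_mk]; fun_prop)
  exact hf.compMeasurePreservingLp hc (fun z => measurePreserving_sub_right volume (a z))
    (by norm_num)

/-- The transform `∫ f(s) exp(iρs) ds`. -/
noncomputable def fhat (ρ : ℂ) (f : ℝ → ℂ) : ℂ := ∫ s : ℝ, Complex.exp (Complex.I * ρ * s) * f s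

theorem fhat_congr {ρ : ℂ} {f g : ℝ → ℂ} (h : f =ᵐ[volume] g) : fhat ρ f = fhat ρ g :=
  integral_congr_ae (h.mono fun s hs => by simp only [hs])

theorem fhat_trans (ρ : ℂ) (a : ℝ) (f : LineL2) :
    fhat ρ (trans a f) = Complex.exp (Complex.I * ρ * a) * fhat ρ f := by
  rw [fhat_congr (trans_ae a f), fhat, fhat, ← integral_const_mul,
    ← integral_sub_right_eq_self (fun s : ℝ => Complex.exp (Complex.I * ρ * a) *
      (Complex.exp (Complex.I * ρ * s) * f s)) a]
  refine integral_congr_ae (Eventually.of_forall fun s => ?_)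
  simp only
  rw [← mul_assoc, ← Complex.exp_add]
  congr 2
  push_cast
  ring

/-- The functions in `L²(ℝ)` supported in `[a, b]`. -/
noncomputable def suppIn (a b : ℝ) : Submodule ℝ LineL2 :=
  (LpToLpRestrictCLM ℝ ℂ ℝ volume 2 (Icc a b)ᶜ).ker

theorem mem_suppIn {a b : ℝ} {f : LineL2} :
    f ∈ suppIn a b ↔ ∀ᵐ s : ℝ, s ∉ Icc a b → f s = 0 := by
  have h := LpToLpRestrictCLM_coeFn ℝ (μ := (volume : Measure ℝ)) (Icc a b)ᶜ f
  have e : (∀ᵐ s : ℝ, s ∉ Icc a b → f s = 0) ↔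
      ∀ᵐ s : ℝ ∂volume.restrict (Icc a b)ᶜ, f s = 0 :=
    (ae_restrict_iff' measurableSet_Icc.compl).symm
  rw [suppIn, LinearMap.mem_ker, Lp.eq_zero_iff_ae_eq_zero, e]
  exact ⟨fun h' => by filter_upwards [h, h'] with s h1 h2; exact h1.symm.trans h2,
    fun h' => by filter_upwards [h, h'] with s h1 h2; exact h1.trans h2⟩

theorem isClosed_suppIn (a b : ℝ) : IsClosed (suppIn a b : Set LineL2) :=
  ContinuousLinearMap.isClosed_ker _

theorem suppIn_mono {a b c d : ℝ} (h1 : c ≤ a) (h2 : b ≤ d) {f : LineL2} (hf : f ∈ suppIn a b) :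
    f ∈ suppIn c d := by
  rw [mem_suppIn] at hf ⊢
  exact hf.mono fun s h hs => h fun h' => hs (Icc_subset_Icc h1 h2 h')

theorem smul_mem_suppIn {a b : ℝ} (c : ℂ) {f : LineL2} (hf : f ∈ suppIn a b) :
    c • f ∈ suppIn a b := by
  rw [mem_suppIn] at hf ⊢
  filter_upwards [hf, Lp.coeFn_smul c f] with s h1 h2 hs
  rw [h2, Pi.smul_apply, h1 hs, smul_zero]

theorem trans_mem_suppIn {a b c d u : ℝ} (h1 : c = a + u) (h2 : d = b + u) {f : LineL2}
    (hf : f ∈ suppIn a b) : trans u f ∈ suppIn c d := by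
  rw [mem_suppIn] at hf ⊢
  filter_upwards [trans_ae u f,
    (measurePreserving_sub_right (volume : Measure ℝ) u).quasiMeasurePreserving.ae hf] with s e h hs
  rw [e]
  refine h fun h' => hs ?_
  rw [h1, h2]
  exact ⟨by linarith [h'.1], by linarith [h'.2]⟩

/-- Restriction to the complement of `[a, b]` is continuous and linear, so it commutes with the
Bochner integral. -/
theorem integral_mem_suppIn {a b u v : ℝ} {g : ℝ → LineL2} (hg : IntervalIntegrable g volume u v)
    (h : ∀ t ∈ uIoc u v, g t ∈ suppIn a b) : ∫ t in u..v, g t ∈ suppIn a b := by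
  rw [suppIn, LinearMap.mem_ker]
  change LpToLpRestrictCLM ℝ ℂ ℝ volume 2 (Icc a b)ᶜ (∫ t in u..v, g t) = 0
  rw [← ContinuousLinearMap.intervalIntegral_comp_comm _ hg]
  exact intervalIntegral.integral_zero_ae (Eventually.of_forall fun t ht => h t ht)

theorem memLp_exp_indicator (ρ : ℂ) (R : ℝ) : MemLp ((Icc (-R) R).indicator
    fun s : ℝ => (starRingEnd ℂ) (Complex.exp (Complex.I * ρ * s))) 2 volume := by
  rw [memLp_indicator_iff_restrict measurableSet_Icc]
  have hc : Continuous fun s : ℝ => (starRingEnd ℂ) (Complex.exp (Complex.I * ρ * s)) := by fun_prop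
  obtain ⟨C, hC⟩ := isCompact_Icc.exists_bound_of_continuousOn hc.continuousOn
  exact MemLp.of_bound hc.aestronglyMeasurable.restrict C
    ((ae_restrict_mem measurableSet_Icc).mono hC)

/-- The transform at `ρ` of the restriction to `[-R, R]`. -/
noncomputable def fhatCLM (ρ : ℂ) (R : ℝ) : LineL2 →L[ℂ] ℂ :=
  innerSL ℂ ((memLp_exp_indicator ρ R).toLp _)

/-- For complex `ρ` the exponential is unbounded, so the transform is not continuous on all of
`L²(ℝ)`. Truncation to `[-R, R]` makes it an inner product with a fixed `L²` function and changes
nothing on the supports that occur. -/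
theorem fhatCLM_eq (ρ : ℂ) {R : ℝ} {f : LineL2} (hf : f ∈ suppIn (-R) R) :
    fhatCLM ρ R f = fhat ρ f := by
  rw [mem_suppIn] at hf
  rw [fhatCLM, innerSL_apply_apply, L2.inner_def, fhat]
  refine integral_congr_ae ?_
  filter_upwards [(memLp_exp_indicator ρ R).coeFn_toLp, hf] with s h1 h2
  rw [h1]
  by_cases hs : s ∈ Icc (-R) R
  · rw [indicator_of_mem hs]
    simp [mul_comm]
  · rw [h2 hs]; simp

/-! ### Dilations and the source densities. -/

/-- The dilation `s ↦ |m|⁻¹ f(s/m)`. -/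
noncomputable def dilate (m : ℝ) (f : ℝ → ℂ) (s : ℝ) : ℂ := ((|m|⁻¹ : ℝ) : ℂ) * f (s * m⁻¹)

theorem dilate_memLp (m : ℝ) {f : ℝ → ℂ} (hf : MemLp f 2 volume) :
    MemLp (dilate m f) 2 volume := by
  rcases eq_or_ne m 0 with rfl | hm
  · convert! (MemLp.zero : MemLp (0 : ℝ → ℂ) 2 volume) using 1
    ext s; simp [dilate]
  · have h : MemLp f 2 (Measure.map (fun s => s * m⁻¹) volume) := by
      rw [Real.map_volume_mul_right (inv_ne_zero hm)]
      exact hf.smul_measure ENNReal.ofReal_ne_top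
    exact (h.comp_of_map (by fun_prop)).const_mul _

/-- The exact factor is `|m|^(-1/2)`; the bound `1` suffices for the values `±1`, `±2` and `-2π` of
`m` that are used. -/
theorem eLpNorm_dilate_le {m : ℝ} (hm : 1 ≤ |m|) {f : ℝ → ℂ} (hf : MemLp f 2 volume) :
    eLpNorm (dilate m f) 2 volume ≤ eLpNorm f 2 volume := by
  have hm0 : m ≠ 0 := by rintro rfl; norm_num at hm
  have h : AEStronglyMeasurable f (Measure.map (fun s => s * m⁻¹) volume) := by
    rw [Real.map_volume_mul_right (inv_ne_zero hm0)]
    exact hf.1.smul_measure _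
  have e : dilate m f = ((|m|⁻¹ : ℝ) : ℂ) • (f ∘ fun s => s * m⁻¹) := rfl
  rw [e, eLpNorm_const_smul, ← eLpNorm_map_measure h (by fun_prop),
    Real.map_volume_mul_right (inv_ne_zero hm0), inv_inv,
    eLpNorm_smul_measure_of_ne_top (by norm_num), smul_eq_mul, ← mul_assoc]
  have hp : 0 < |m| := by linarith
  have : ‖((|m|⁻¹ : ℝ) : ℂ)‖ₑ * ENNReal.ofReal |m| ^ (1 / 2 : ℝ≥0∞).toReal ≤ 1 := by
    rw [← ofReal_norm, Complex.norm_real, Real.norm_eq_abs, abs_of_pos (inv_pos.2 hp),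
      ENNReal.ofReal_rpow_of_pos hp, ← ENNReal.ofReal_mul (inv_pos.2 hp).le, ENNReal.ofReal_le_one]
    rw [inv_mul_le_iff₀ hp, mul_one]
    calc |m| ^ (1 / 2 : ℝ≥0∞).toReal ≤ |m| ^ (1:ℝ) :=
          Real.rpow_le_rpow_of_exponent_le hm (by norm_num)
      _ = |m| := Real.rpow_one _
  exact (mul_le_mul_left this _).trans (one_mul _).le

theorem fhat_dilate (ρ : ℂ) {m : ℝ} (hm : m ≠ 0) (f : ℝ → ℂ) :
    fhat ρ (dilate m f) = fhat (ρ * m) f := by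
  rw [fhat, fhat]
  have h := Measure.integral_comp_mul_right
    (fun s : ℝ => Complex.exp (Complex.I * (ρ * m) * s) * f s) m⁻¹
  rw [inv_inv] at h
  have hm' : ((|m|⁻¹ : ℝ) : ℂ) * ((|m| : ℝ) : ℂ) = 1 := by
    rw [← Complex.ofReal_mul, inv_mul_cancel₀ (abs_ne_zero.2 hm), Complex.ofReal_one]
  calc _ = ∫ s : ℝ, ((|m|⁻¹ : ℝ) : ℂ) *
        (Complex.exp (Complex.I * (ρ * m) * (s * m⁻¹ : ℝ)) * f (s * m⁻¹)) := by
        refine integral_congr_ae (Eventually.of_forall fun s => ?_)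
        have : (Complex.I * (ρ * m) * (s * m⁻¹ : ℝ)) = Complex.I * ρ * s := by
          have : (m : ℂ) ≠ 0 := by exact_mod_cast hm
          push_cast; field_simp
        simp only [this, dilate]
        ring
    _ = _ := by
        rw [integral_const_mul, h, Complex.real_smul, ← mul_assoc, hm', one_mul]

/-- The density in `s = mt` of the measure `f(t) dt` on `(0, x)`. -/
noncomputable def src (m : ℝ) {f : ℝ → ℂ} (hf : MemLp f 2 volume) (x : ℝ) : LineL2 :=
  (dilate_memLp m (hf.indicator (measurableSet_Ioo (a := 0) (b := x)))).toLp _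

theorem src_ae (m : ℝ) {f : ℝ → ℂ} (hf : MemLp f 2 volume) (x : ℝ) :
    src m hf x =ᵐ[volume] dilate m ((Ioo 0 x).indicator f) := MemLp.coeFn_toLp _

theorem norm_src_sub_le_aux {m : ℝ} (hm : 1 ≤ |m|) {f g : ℝ → ℂ} (hf : MemLp f 2 volume)
    (hg : MemLp g 2 volume) (x y : ℝ) : ‖src m hf x - src m hg y‖ ≤
      (eLpNorm ((Ioo 0 x).indicator f - (Ioo 0 y).indicator g) 2 volume).toReal := by
  have h1 := hf.indicator (measurableSet_Ioo (a := (0:ℝ)) (b := x))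
  have h2 := hg.indicator (measurableSet_Ioo (a := (0:ℝ)) (b := y))
  rw [src, src, ← MemLp.toLp_sub, Lp.norm_toLp]
  refine ENNReal.toReal_mono (h1.sub h2).2.ne ?_
  refine le_trans (le_of_eq ?_) (eLpNorm_dilate_le hm (h1.sub h2))
  congr 1
  ext s
  simp [dilate, mul_sub]

theorem normOn_eq_indicator (x : ℝ) (f : ℝ → ℂ) :
    normOn x f = eLpNorm ((Ioo 0 x).indicator f) 2 volume :=
  (eLpNorm_indicator_eq_eLpNorm_restrict measurableSet_Ioo).symm

theorem norm_src_sub_le {m : ℝ} (hm : 1 ≤ |m|) {f g : ℝ → ℂ} (hf : MemLp f 2 volume)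
    (hg : MemLp g 2 volume) (x : ℝ) : ‖src m hf x - src m hg x‖ ≤ (normOn x (f - g)).toReal := by
  refine (norm_src_sub_le_aux hm hf hg x x).trans (le_of_eq ?_)
  rw [normOn_eq_indicator, indicator_sub']

theorem norm_src_le {m : ℝ} (hm : 1 ≤ |m|) {f : ℝ → ℂ} (hf : MemLp f 2 volume) (x : ℝ) :
    ‖src m hf x‖ ≤ (normOn x f).toReal := by
  have h1 := hf.indicator (measurableSet_Ioo (a := (0:ℝ)) (b := x))
  rw [src, Lp.norm_toLp, normOn_eq_indicator]
  exact ENNReal.toReal_mono h1.2.ne (eLpNorm_dilate_le hm h1)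

/-- Moving the endpoint from `x` to `y` changes the density only over the interval between them, and
the `L²` norm of `f` over short intervals is small. -/
theorem continuous_src {m : ℝ} (hm : 1 ≤ |m|) {f : ℝ → ℂ} (hf : MemLp f 2 volume) :
    Continuous (src m hf) := by
  rw [Metric.continuous_iff]
  intro x ε hε
  obtain ⟨δ, hδ, h⟩ := hf.eLpNorm_indicator_le one_le_two (by norm_num) (half_pos hε)
  refine ⟨δ, hδ, fun y hy => ?_⟩
  rw [dist_eq_norm]
  have h1 := norm_src_sub_le_aux hm hf hf y x
  have hs := h (uIcc y x) measurableSet_uIcc (by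
    rw [Real.volume_interval]
    exact ENNReal.ofReal_le_ofReal (by rw [← Real.dist_eq, dist_comm]; exact hy.le))
  have h2 : eLpNorm ((Ioo 0 y).indicator f - (Ioo 0 x).indicator f) 2 volume ≤
      ENNReal.ofReal (ε / 2) := by
    refine (eLpNorm_mono fun s => ?_).trans hs
    simp only [Pi.sub_apply]
    by_cases h3 : s ∈ uIcc y x
    · rw [indicator_of_mem h3]
      simp only [indicator]
      split_ifs <;> simp
    · rw [indicator_of_notMem h3]
      have : s ∈ Ioo 0 y ↔ s ∈ Ioo 0 x := by
        rw [mem_uIcc] at h3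
        push Not at h3
        simp only [mem_Ioo]
        constructor <;> rintro ⟨h5, h6⟩ <;> refine ⟨h5, ?_⟩ <;> by_contra! h7
        · exact absurd h6 (not_lt.2 (h3.2 h7).le)
        · exact absurd h6 (not_lt.2 (h3.1 h7).le)
      simp only [indicator, this]
      split_ifs <;> simp
  refine (h1.trans (ENNReal.toReal_mono ENNReal.ofReal_ne_top h2)).trans_lt ?_
  rw [ENNReal.toReal_ofReal (by positivity)]
  linarith

theorem src_mem_suppIn {m a b x : ℝ} (hm : m ≠ 0) {f : ℝ → ℂ} (hf : MemLp f 2 volume)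
    (h : ∀ t ∈ Ioo 0 x, m * t ∈ Icc a b) : src m hf x ∈ suppIn a b := by
  rw [mem_suppIn]
  filter_upwards [src_ae m hf x] with s e hs
  rw [e, dilate, indicator_of_notMem, mul_zero]
  intro h'
  refine hs ?_
  have := h _ h'
  rwa [mul_comm s, mul_inv_cancel_left₀ hm] at this

theorem fhat_src (ρ : ℂ) {m x : ℝ} (hm : m ≠ 0) (hx : 0 ≤ x) {f : ℝ → ℂ} (hf : MemLp f 2 volume) :
    fhat ρ (src m hf x) = ∫ t in (0:ℝ)..x, Complex.exp (Complex.I * (ρ * m) * t) * f t := by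
  rw [fhat_congr (src_ae m hf x), fhat_dilate ρ hm, fhat, intervalIntegral.integral_of_le hx,
    integral_Ioc_eq_integral_Ioo, ← integral_indicator measurableSet_Ioo]
  refine integral_congr_ae (Eventually.of_forall fun s => ?_)
  simp only [indicator]
  split_ifs <;> simp

/-! ### Plancherel's theorem for the exponential transform. -/

theorem integrable_of_mem_suppIn {a b : ℝ} {f : LineL2} (hf : f ∈ suppIn a b) :
    Integrable (f : ℝ → ℂ) := by
  have h1 : IntegrableOn (f : ℝ → ℂ) (Icc a b) :=
    ((Lp.memLp f).restrict (Icc a b)).integrable one_le_two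
  refine (h1.integrable_indicator measurableSet_Icc).congr ?_
  filter_upwards [mem_suppIn.1 hf] with s hs
  by_cases h : s ∈ Icc a b
  · rw [indicator_of_mem h]
  · rw [indicator_of_notMem h, hs h]

-- The Fourier transform on `L²` is an extension by continuity, so its agreement with the integral
-- must be shown. Both sides are tested against smooth compactly supported functions, and the
-- transform is moved to the test function on each side.
open FourierTransform in
theorem fourier_ae_eq_integral {f : LineL2} (hf : Integrable (f : ℝ → ℂ)) :
    ((𝓕 f : LineL2) : ℝ → ℂ) =ᵐ[volume] 𝓕 (f : ℝ → ℂ) := by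
  have hc : Continuous (𝓕 (f : ℝ → ℂ)) :=
    VectorFourier.fourierIntegral_continuous Real.continuous_fourierChar
      (by exact continuous_inner) hf
  refine ae_eq_of_integral_contDiff_smul_eq ((Lp.memLp _).locallyIntegrable one_le_two)
    hc.locallyIntegrable fun g hg hgc => ?_
  have hg₁ : HasCompactSupport (Complex.ofRealCLM ∘ g) := hgc.comp_left rfl
  have hg₂ : ContDiff ℝ ((⊤ : ℕ∞) : WithTop ℕ∞) (Complex.ofRealCLM ∘ g) :=
    Complex.ofRealCLM.contDiff.comp hg
  let G := hg₁.toSchwartzMap hg₂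
  have hG (x : ℝ) : G x = (g x : ℂ) := rfl
  have e1 := DFunLike.congr_fun (Lp.fourier_toTemperedDistribution_eq f) G
  rw [TemperedDistribution.fourier_apply, Lp.toTemperedDistribution_apply,
    Lp.toTemperedDistribution_apply] at e1
  have e2 := VectorFourier.integral_fourierIntegral_smul_eq_flip (L := innerₗ ℝ)
    (μ := volume) (ν := volume) Real.continuous_fourierChar
    (by exact continuous_inner) G.integrable hf
  rw [flip_innerₗ] at e2
  have e3 : ∫ x, (𝓕 G) x • f x = ∫ x, G x • 𝓕 (f : ℝ → ℂ) x := by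
    rw [SchwartzMap.fourier_coe]
    exact e2
  rw [e3] at e1
  simp only [hG, Complex.coe_smul] at e1
  exact e1.symm

open FourierTransform in
theorem fhat_eq_fourier (f : ℝ → ℂ) (ρ : ℝ) :
    fhat ρ f = 𝓕 f (ρ * (-(2 * Real.pi))⁻¹) := by
  rw [Real.fourier_eq, fhat]
  refine integral_congr_ae (Eventually.of_forall fun s => ?_)
  simp only [Circle.smul_def, smul_eq_mul, Real.fourierChar_apply]
  congr 2
  have := Real.pi_ne_zero
  have e : 2 * Real.pi * (-inner ℝ s (ρ * (-(2 * Real.pi))⁻¹)) = ρ * s := by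
    rw [real_inner_eq_re_inner ℝ]
    simp only [RCLike.inner_apply, conj_trivial, RCLike.re_to_real]
    field_simp
  rw [e]
  push_cast
  ring

open FourierTransform in
theorem fhat_memLp {a b : ℝ} {f : LineL2} (hf : f ∈ suppIn a b) :
    MemLp (fun ρ : ℝ => fhat ρ f) 2 volume ∧
      eLpNorm (fun ρ : ℝ => fhat ρ f) 2 volume ≤ ENNReal.ofReal (2 * Real.pi * ‖f‖) := by
  have hpi := Real.pi_gt_three
  set m : ℝ := -(2 * Real.pi) with hm
  have hm1 : |m| = 2 * Real.pi := by rw [hm, abs_neg, abs_of_pos (by positivity)]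
  have hF := fourier_ae_eq_integral (integrable_of_mem_suppIn hf)
  have hL : MemLp (𝓕 (f : ℝ → ℂ)) 2 volume := (memLp_congr_ae hF).1 (Lp.memLp _)
  -- The frequency is `-ρ/(2π)`; the factor `2π` cancels the normalization `|m|⁻¹` of the dilation.
  -- The resulting constant `2π` is not sharp.
  have e : (fun ρ : ℝ => fhat ρ f) = ((2 * Real.pi : ℝ) : ℂ) • dilate m (𝓕 (f : ℝ → ℂ)) := by
    ext ρ
    rw [Pi.smul_apply, dilate, fhat_eq_fourier, hm1, smul_eq_mul, ← mul_assoc,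
      ← Complex.ofReal_mul, mul_inv_cancel₀ (by positivity), Complex.ofReal_one, one_mul]
  rw [e]
  refine ⟨(dilate_memLp m hL).const_smul _, ?_⟩
  rw [eLpNorm_const_smul, ENNReal.ofReal_mul (by positivity), ← ofReal_norm, Complex.norm_real,
    Real.norm_eq_abs, abs_of_pos (by positivity)]
  refine mul_le_mul_right ((eLpNorm_dilate_le (by rw [hm1]; linarith) hL).trans ?_) _
  rw [← eLpNorm_congr_ae hF, ← Lp.norm_fourier_eq f, ofReal_norm, Lp.enorm_def]

/-! ### The `ρ`-free Volterra equation for the kernels in `L²(ℝ)³`. -/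

/-- The indicator function of `(0, T)`. -/
noncomputable def chi (T : ℝ) : ℝ → ℂ := (Ioo 0 T).indicator fun _ => 1

/-- The restriction of `σ` to `(0, T)`, extended by zero. -/
noncomputable def cut (T : ℝ) (σ : ℝ → ℂ) : ℝ → ℂ := (Ioo 0 T).indicator σ

theorem cut_memLp {T : ℝ} {σ : ℝ → ℂ} (hσ : InL2 T σ) : MemLp (cut T σ) 2 volume :=
  (memLp_indicator_iff_restrict measurableSet_Ioo).2 hσ

theorem chi_memLp (T : ℝ) : MemLp (chi T) 2 volume :=
  memLp_indicator_const 2 measurableSet_Ioo 1 (Or.inr (by simp))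

theorem chi_integrable (T : ℝ) : Integrable (chi T) :=
  (integrable_indicator_iff measurableSet_Ioo).2 (integrableOn_const (by simp))

theorem norm_chi_le (T t : ℝ) : ‖chi T t‖ ≤ 1 := by
  rw [chi, indicator]; split_ifs <;> simp

/-- The dominating function `|σ| + |σ|² + 1` of the coefficients. -/
noncomputable def dom (T : ℝ) (σ : ℝ → ℂ) (t : ℝ) : ℝ := ‖cut T σ t‖ + ‖cut T σ t‖ ^ 2 + ‖chi T t‖

theorem dom_nonneg (T : ℝ) (σ : ℝ → ℂ) (t : ℝ) : 0 ≤ dom T σ t := by unfold dom; positivity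

theorem cut_integrable {T : ℝ} {σ : ℝ → ℂ} (hσ : InL2 T σ) : Integrable (cut T σ) :=
  (integrable_indicator_iff measurableSet_Ioo).2 (hσ.integrable one_le_two)

theorem cut_sq_integrable {T : ℝ} {σ : ℝ → ℂ} (hσ : InL2 T σ) :
    Integrable (fun t => cut T σ t ^ 2) := by
  simp only [pow_two]
  exact (cut_memLp hσ).integrable_mul (cut_memLp hσ)

theorem dom_integrable {T : ℝ} {σ : ℝ → ℂ} (hσ : InL2 T σ) : Integrable (dom T σ) := by
  refine ((cut_integrable hσ).norm.add ?_).add (chi_integrable T).norm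
  exact (cut_sq_integrable hσ).norm.congr (Eventually.of_forall fun t => norm_pow _ _)

/-- Triples of functions in `L²(ℝ)`. -/
abbrev Triple : Type := LineL2 × LineL2 × LineL2

/-- The coefficient operator of the Volterra equation for the kernels. -/
noncomputable def kerOp (T : ℝ) (σ : ℝ → ℂ) (t : ℝ) (h : Triple) : Triple :=
  (cut T σ t • trans (-(2 * t)) h.2.1 + (Complex.I * cut T σ t ^ 2) • trans (-t) h.2.2,
    cut T σ t • trans (2 * t) h.1 - (Complex.I * cut T σ t ^ 2) • trans t h.2.2,
    cut T σ t • h.2.2 + (chi T t * (Complex.I / 2)) • (trans t h.1 - trans (-t) h.2.1))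

theorem norm_fst_le_triple (h : Triple) : ‖h.1‖ ≤ ‖h‖ := norm_fst_le h
theorem norm_snd_fst_le_triple (h : Triple) : ‖h.2.1‖ ≤ ‖h‖ :=
  (norm_fst_le h.2).trans (norm_snd_le h)
theorem norm_snd_snd_le_triple (h : Triple) : ‖h.2.2‖ ≤ ‖h‖ :=
  (norm_snd_le h.2).trans (norm_snd_le h)

theorem norm_half_I : ‖Complex.I / 2‖ = 1 / 2 := by simp

/-- The common estimate of the operators with scalar coefficients `a`, `b`, `e`. -/
theorem norm_triple_le (a b e : ℂ) (t : ℝ) (h : Triple) :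
    ‖((a • trans (-(2 * t)) h.2.1 + (Complex.I * b) • trans (-t) h.2.2,
    a • trans (2 * t) h.1 - (Complex.I * b) • trans t h.2.2,
    a • h.2.2 + (e * (Complex.I / 2)) • (trans t h.1 - trans (-t) h.2.1)) : Triple)‖ ≤
      (‖a‖ + ‖b‖ + ‖e‖) * ‖h‖ := by
  have h1 := norm_fst_le_triple h
  have h2 := norm_snd_fst_le_triple h
  have h3 := norm_snd_snd_le_triple h
  have hn := norm_nonneg h
  have ea : 0 ≤ ‖a‖ := norm_nonneg _
  have eb : 0 ≤ ‖b‖ := norm_nonneg _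
  have ee : 0 ≤ ‖e‖ := norm_nonneg _
  have hee := mul_nonneg ee hn
  have hbb := mul_nonneg eb hn
  rw [norm_prod_le_iff, norm_prod_le_iff]
  refine ⟨(norm_add_le _ _).trans ?_, (norm_sub_le _ _).trans ?_, (norm_add_le _ _).trans ?_⟩
  · simp only [norm_smul, norm_mul, Complex.norm_I, one_mul, LinearIsometry.norm_map]
    nlinarith [mul_le_mul_of_nonneg_left h2 ea, mul_le_mul_of_nonneg_left h3 eb]
  · simp only [norm_smul, norm_mul, Complex.norm_I, one_mul, LinearIsometry.norm_map]
    nlinarith [mul_le_mul_of_nonneg_left h1 ea, mul_le_mul_of_nonneg_left h3 eb]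
  · have h4 : ‖trans t h.1 - trans (-t) h.2.1‖ ≤ 2 * ‖h‖ := by
      refine (norm_sub_le _ _).trans ?_
      simp only [LinearIsometry.norm_map]
      linarith
    rw [norm_smul, norm_smul, norm_mul, norm_half_I]
    nlinarith [mul_le_mul_of_nonneg_left h3 ea, mul_le_mul_of_nonneg_left h4 ee]

theorem kerOp_isVolterra {T : ℝ} {σ : ℝ → ℂ} (hσ : InL2 T σ) :
    IsVolterra (dom T σ) (kerOp T σ) where
  integrable := dom_integrable hσ
  nonneg := dom_nonneg T σ
  map_sub t u v := by
    simp only [kerOp, Prod.fst_sub, Prod.snd_sub, map_sub, Prod.mk_sub_mk, smul_sub]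
    refine Prod.ext ?_ (Prod.ext ?_ ?_) <;> simp only <;> abel
  norm_le t u := by
    have := norm_triple_le (cut T σ t) (cut T σ t ^ 2) (chi T t) t u
    rwa [norm_pow] at this
  meas Z hZ := by
    have m1 : AEStronglyMeasurable (cut T σ) := (cut_integrable hσ).1
    have m2 : AEStronglyMeasurable (fun t => Complex.I * cut T σ t ^ 2) :=
      ((cut_sq_integrable hσ).const_mul _).1
    have m3 : AEStronglyMeasurable (fun t => chi T t * (Complex.I / 2)) :=
      ((chi_integrable T).mul_const _).1
    have c1 : Continuous fun t => (Z t).1 := by fun_prop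
    have c2 : Continuous fun t => (Z t).2.1 := by fun_prop
    have c3 : Continuous fun t => (Z t).2.2 := by fun_prop
    refine AEStronglyMeasurable.prodMk ?_ (AEStronglyMeasurable.prodMk ?_ ?_)
    · exact (m1.smul (continuous_trans (by fun_prop) c2).aestronglyMeasurable).add
        (m2.smul (continuous_trans (by fun_prop) c3).aestronglyMeasurable)
    · exact (m1.smul (continuous_trans (by fun_prop) c1).aestronglyMeasurable).sub
        (m2.smul (continuous_trans (by fun_prop) c3).aestronglyMeasurable)
    · exact (m1.smul c3.aestronglyMeasurable).add
        (m3.smul ((continuous_trans continuous_id c1).sub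
          (continuous_trans continuous_neg c2)).aestronglyMeasurable)

/-- The dominating function of the difference of two coefficient operators. -/
noncomputable def domDiff (T : ℝ) (σ τ : ℝ → ℂ) (t : ℝ) : ℝ :=
  ‖cut T σ t - cut T τ t‖ + ‖cut T σ t ^ 2 - cut T τ t ^ 2‖

theorem domDiff_nonneg (T : ℝ) (σ τ : ℝ → ℂ) (t : ℝ) : 0 ≤ domDiff T σ τ t := by
  unfold domDiff; positivity

theorem domDiff_integrable {T : ℝ} {σ τ : ℝ → ℂ} (hσ : InL2 T σ) (hτ : InL2 T τ) :
    Integrable (domDiff T σ τ) :=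
  ((cut_integrable hσ).sub (cut_integrable hτ)).norm.add
    ((cut_sq_integrable hσ).sub (cut_sq_integrable hτ)).norm

theorem norm_kerOp_sub_le (T : ℝ) (σ τ : ℝ → ℂ) (t : ℝ) (h : Triple) :
    ‖kerOp T σ t h - kerOp T τ t h‖ ≤ domDiff T σ τ t * ‖h‖ := by
  have := norm_triple_le (cut T σ t - cut T τ t) (cut T σ t ^ 2 - cut T τ t ^ 2) 0 t h
  rw [norm_zero, add_zero] at this
  refine le_trans (le_of_eq (congrArg _ ?_)) this
  refine Prod.ext ?_ (Prod.ext ?_ ?_) <;>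
    simp only [kerOp, Prod.fst_sub, Prod.snd_sub, sub_smul, mul_sub, zero_mul, zero_smul] <;> abel

/-- The inhomogeneous term of the Volterra equation for the kernels. -/
noncomputable def kerSrc (T : ℝ) {σ c : ℝ → ℂ} (hσ : InL2 T σ) (hc : InL2 T c) (α β : ℂ) (x : ℝ) :
    Triple :=
  (β • src (-2) (cut_memLp hσ) x + src (-1) (cut_memLp hc) x,
    α • src 2 (cut_memLp hσ) x + src 1 (cut_memLp hc) x,
    (Complex.I / 2) • (α • src 1 (chi_memLp T) x - β • src (-1) (chi_memLp T) x))

theorem continuous_kerSrc {T : ℝ} {σ c : ℝ → ℂ} (hσ : InL2 T σ) (hc : InL2 T c) (α β : ℂ) :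
    Continuous (kerSrc T hσ hc α β) := by
  have h1 := continuous_src (m := -2) (by norm_num) (cut_memLp hσ)
  have h2 := continuous_src (m := 2) (by norm_num) (cut_memLp hσ)
  have h3 := continuous_src (m := -1) (by norm_num) (cut_memLp hc)
  have h4 := continuous_src (m := 1) (by norm_num) (cut_memLp hc)
  have h5 := continuous_src (m := -1) (by norm_num) (chi_memLp T)
  have h6 := continuous_src (m := 1) (by norm_num) (chi_memLp T)
  unfold kerSrc
  fun_prop

/-- The supports of the kernels at `x`. -/
noncomputable def kerSupp (x : ℝ) : Submodule ℝ Triple :=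
  (suppIn (-(2 * x)) 0).prod ((suppIn 0 (2 * x)).prod (suppIn (-x) x))

theorem isClosed_kerSupp (x : ℝ) : IsClosed (kerSupp x : Set Triple) :=
  (isClosed_suppIn _ _).prod ((isClosed_suppIn _ _).prod (isClosed_suppIn _ _))

theorem kerSupp_mono {x y : ℝ} (h : x ≤ y) {f : Triple} (hf : f ∈ kerSupp x) : f ∈ kerSupp y :=
  ⟨suppIn_mono (by linarith) le_rfl hf.1, suppIn_mono le_rfl (by linarith) hf.2.1,
    suppIn_mono (by linarith) h hf.2.2⟩

theorem kerSrc_mem {T : ℝ} {σ c : ℝ → ℂ} (hσ : InL2 T σ) (hc : InL2 T c) (α β : ℂ) (x : ℝ) :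
    kerSrc T hσ hc α β x ∈ kerSupp x := by
  refine ⟨add_mem (smul_mem_suppIn _ (src_mem_suppIn (by norm_num) _ ?_))
    (src_mem_suppIn (by norm_num) _ ?_), add_mem (smul_mem_suppIn _ (src_mem_suppIn (by norm_num) _ ?_))
    (src_mem_suppIn (by norm_num) _ ?_), smul_mem_suppIn _ (sub_mem
      (smul_mem_suppIn _ (src_mem_suppIn (by norm_num) _ ?_))
      (smul_mem_suppIn _ (src_mem_suppIn (by norm_num) _ ?_)))⟩ <;>
  · intro t ht
    have := ht.1
    have := ht.2
    constructor <;> linarith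

/-- The three intervals `[-2t, 0]`, `[0, 2t]`, `[-t, t]` are translates of one another by exactly
the shifts that occur in `kerOp`. -/
theorem kerOp_mem (T : ℝ) (σ : ℝ → ℂ) {t : ℝ} {h : Triple} (hh : h ∈ kerSupp t) :
    kerOp T σ t h ∈ kerSupp t := by
  obtain ⟨h1, h2, h3⟩ := hh
  refine ⟨add_mem (smul_mem_suppIn _ (trans_mem_suppIn ?_ ?_ h2))
      (smul_mem_suppIn _ (trans_mem_suppIn ?_ ?_ h3)),
    sub_mem (smul_mem_suppIn _ (trans_mem_suppIn ?_ ?_ h1))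
      (smul_mem_suppIn _ (trans_mem_suppIn ?_ ?_ h3)),
    add_mem (smul_mem_suppIn _ h3) (smul_mem_suppIn _ (sub_mem (trans_mem_suppIn ?_ ?_ h1)
      (trans_mem_suppIn ?_ ?_ h2)))⟩ <;> ring

theorem intervalIntegral_fst {E F : Type*} [NormedAddCommGroup E] [NormedSpace ℝ E]
    [CompleteSpace E] [NormedAddCommGroup F] [NormedSpace ℝ F] [CompleteSpace F] {g : ℝ → E × F}
    {u v : ℝ} (hg : IntervalIntegrable g volume u v) :
    (∫ t in u..v, g t).1 = ∫ t in u..v, (g t).1 :=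
  ((ContinuousLinearMap.fst ℝ E F).intervalIntegral_comp_comm hg).symm

theorem intervalIntegral_snd {E F : Type*} [NormedAddCommGroup E] [NormedSpace ℝ E]
    [CompleteSpace E] [NormedAddCommGroup F] [NormedSpace ℝ F] [CompleteSpace F] {g : ℝ → E × F}
    {u v : ℝ} (hg : IntervalIntegrable g volume u v) :
    (∫ t in u..v, g t).2 = ∫ t in u..v, (g t).2 :=
  ((ContinuousLinearMap.snd ℝ E F).intervalIntegral_comp_comm hg).symm

theorem intervalIntegrable_fst {E F : Type*} [NormedAddCommGroup E] [NormedSpace ℝ E]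
    [NormedAddCommGroup F] [NormedSpace ℝ F] {g : ℝ → E × F} {u v : ℝ} (hg : IntervalIntegrable g volume u v) :
    IntervalIntegrable (fun t => (g t).1) volume u v := ⟨hg.1.fst, hg.2.fst⟩

theorem intervalIntegrable_snd {E F : Type*} [NormedAddCommGroup E] [NormedSpace ℝ E]
    [NormedAddCommGroup F] [NormedSpace ℝ F] {g : ℝ → E × F} {u v : ℝ} (hg : IntervalIntegrable g volume u v) :
    IntervalIntegrable (fun t => (g t).2) volume u v := ⟨hg.1.snd, hg.2.snd⟩

theorem integral_mem_kerSupp {x : ℝ} (hx : 0 ≤ x) {g : ℝ → Triple}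
    (hg : IntervalIntegrable g volume 0 x) (h : ∀ t ∈ Ioc 0 x, g t ∈ kerSupp x) :
    ∫ t in (0:ℝ)..x, g t ∈ kerSupp x := by
  rw [← uIoc_of_le hx] at h
  refine ⟨?_, ?_, ?_⟩
  · rw [intervalIntegral_fst hg]
    exact integral_mem_suppIn (intervalIntegrable_fst hg) fun t ht => (h t ht).1
  · rw [intervalIntegral_snd hg, intervalIntegral_fst (intervalIntegrable_snd hg)]
    exact integral_mem_suppIn (intervalIntegrable_fst (intervalIntegrable_snd hg))
      fun t ht => (h t ht).2.1
  · rw [intervalIntegral_snd hg, intervalIntegral_snd (intervalIntegrable_snd hg)]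
    exact integral_mem_suppIn (intervalIntegrable_snd (intervalIntegrable_snd hg))
      fun t ht => (h t ht).2.2

/-- The Volterra equation for the kernels. -/
structure IsKernel (T : ℝ) {σ c : ℝ → ℂ} (hσ : InL2 T σ) (hc : InL2 T c) (α β : ℂ)
    (Y : ℝ → Triple) : Prop where
  continuous : Continuous Y
  eqn : ∀ x ∈ Icc 0 T, Y x = kerSrc T hσ hc α β x + ∫ t in (0:ℝ)..x, kerOp T σ t (Y t)
  mem : ∀ x ∈ Icc 0 T, Y x ∈ kerSupp x

theorem exists_isKernel {T : ℝ} (hT : 0 ≤ T) {σ c : ℝ → ℂ} (hσ : InL2 T σ) (hc : InL2 T c)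
    (α β : ℂ) : ∃ Y, IsKernel T hσ hc α β Y := by
  have h := kerOp_isVolterra hσ
  obtain ⟨Y, h1, h2, h3⟩ := h.exists_solution hT (continuous_kerSrc hσ hc α β) kerSupp
    isClosed_kerSupp (fun Z hZ hm x hx => add_mem (kerSrc_mem hσ hc α β x)
      (integral_mem_kerSupp hx.1 (h.intervalIntegrable hZ 0 x) fun t ht =>
        kerSupp_mono ht.2 (kerOp_mem T σ (hm t ⟨ht.1.le, ht.2.trans hx.2⟩))))
  exact ⟨Y, h1, h2, h3⟩

/-! ### The scalar integral equation at a fixed `ρ`. -/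

/-- The exponential `exp(iρt)`. -/
noncomputable def wave (ρ : ℂ) (t : ℝ) : ℂ := Complex.exp (Complex.I * ρ * t)

theorem wave_add (ρ : ℂ) (s t : ℝ) : wave ρ (s + t) = wave ρ s * wave ρ t := by
  rw [wave, wave, wave, ← Complex.exp_add]; congr 1; push_cast; ring

theorem wave_zero (ρ : ℂ) : wave ρ 0 = 1 := by simp [wave]

theorem wave_neg_mul (ρ : ℂ) (t : ℝ) : wave ρ (-t) * wave ρ t = 1 := by
  rw [← wave_add, neg_add_cancel, wave_zero]

theorem continuous_wave (ρ : ℂ) : Continuous (wave ρ) := by unfold wave; fun_prop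

theorem norm_wave_le (ρ : ℂ) {t R : ℝ} (h : |t| ≤ R) : ‖wave ρ t‖ ≤ Real.exp (‖ρ‖ * R) := by
  rw [wave, Complex.norm_exp]
  refine Real.exp_le_exp.2 ((Complex.re_le_norm _).trans ?_)
  rw [norm_mul, norm_mul, Complex.norm_I, one_mul, Complex.norm_real, Real.norm_eq_abs]
  exact mul_le_mul_of_nonneg_left h (norm_nonneg _)

theorem hasDerivAt_wave (ρ : ℂ) (m t : ℝ) :
    HasDerivAt (fun t => wave ρ (m * t)) (Complex.I * ρ * m * wave ρ (m * t)) t := by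
  have h1 : HasDerivAt (fun t : ℝ => Complex.I * ρ * ((m * t : ℝ) : ℂ)) (Complex.I * ρ * m) t := by
    have := (((hasDerivAt_id t).const_mul m).ofReal_comp).const_mul (Complex.I * ρ)
    simpa using this
  convert! h1.cexp using 1
  exact mul_comm _ _

theorem ac_wave (ρ : ℂ) (m T : ℝ) :
    AbsolutelyContinuousOnInterval (fun t => wave ρ (m * t)) 0 T := by
  refine ContDiffOn.absolutelyContinuousOnInterval (ContDiff.contDiffOn ?_)
  unfold wave
  have : ContDiff ℝ 1 fun t : ℝ => ((m * t : ℝ) : ℂ) :=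
    Complex.ofRealCLM.contDiff.comp (contDiff_const.mul contDiff_id)
  exact (contDiff_const.mul this).cexp

/-- The linear part of the system for fixed `ρ`. -/
noncomputable def scalLin (T : ℝ) (σ : ℝ → ℂ) (ρ : ℂ) (t : ℝ) (z : ℂ × ℂ × ℂ) : ℂ × ℂ × ℂ :=
  (cut T σ t * (wave ρ (-(2 * t)) * z.2.1) +
      Complex.I * cut T σ t ^ 2 * (wave ρ (-t) * z.2.2),
    cut T σ t * (wave ρ (2 * t) * z.1) - Complex.I * cut T σ t ^ 2 * (wave ρ t * z.2.2),
    cut T σ t * z.2.2 + chi T t * (Complex.I / 2) * (wave ρ t * z.1 - wave ρ (-t) * z.2.1))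

/-- The inhomogeneous part of the system for fixed `ρ`. -/
noncomputable def scalInh (T : ℝ) (c : ℝ → ℂ) (ρ : ℂ) (t : ℝ) : ℂ × ℂ × ℂ :=
  (wave ρ (-t) * cut T c t, wave ρ t * cut T c t, 0)

theorem scalLin_add (T : ℝ) (σ : ℝ → ℂ) (ρ : ℂ) (t : ℝ) (z w : ℂ × ℂ × ℂ) :
    scalLin T σ ρ t (z + w) = scalLin T σ ρ t z + scalLin T σ ρ t w := by
  refine Prod.ext ?_ (Prod.ext ?_ ?_) <;> simp only [scalLin, Prod.fst_add, Prod.snd_add] <;> ring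

theorem scalLin_sub (T : ℝ) (σ : ℝ → ℂ) (ρ : ℂ) (t : ℝ) (z w : ℂ × ℂ × ℂ) :
    scalLin T σ ρ t (z - w) = scalLin T σ ρ t z - scalLin T σ ρ t w := by
  refine Prod.ext ?_ (Prod.ext ?_ ?_) <;> simp only [scalLin, Prod.fst_sub, Prod.snd_sub] <;> ring

/-- All shifts are at most `2T` in absolute value. The bound grows with `ρ`, which is harmless: it
serves only uniqueness at a fixed `ρ`. -/
theorem norm_scalLin_le {T : ℝ} (σ : ℝ → ℂ) (ρ : ℂ) {t : ℝ} (ht : t ∈ Icc 0 T) (z : ℂ × ℂ × ℂ) :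
    ‖scalLin T σ ρ t z‖ ≤ Real.exp (‖ρ‖ * (2 * T)) * dom T σ t * ‖z‖ := by
  set κ := Real.exp (‖ρ‖ * (2 * T)) with hκ
  have ht0 := ht.1
  have htT := ht.2
  have hκ1 : 1 ≤ κ := Real.one_le_exp (mul_nonneg (norm_nonneg _) (by linarith))
  have hn := norm_nonneg z
  have w (s : ℝ) (hs : |s| ≤ 2 * T) (y : ℂ) (hy : ‖y‖ ≤ ‖z‖) : ‖wave ρ s * y‖ ≤ κ * ‖z‖ := by
    rw [norm_mul]
    exact mul_le_mul (norm_wave_le ρ hs) hy (norm_nonneg _) (by positivity)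
  have h1 : ‖z.1‖ ≤ ‖z‖ := norm_fst_le z
  have h2 : ‖z.2.1‖ ≤ ‖z‖ := (norm_fst_le z.2).trans (norm_snd_le z)
  have h3 : ‖z.2.2‖ ≤ ‖z‖ := (norm_snd_le z.2).trans (norm_snd_le z)
  have b1 : |-(2 * t)| ≤ 2 * T := by rw [abs_neg, abs_of_nonneg (by linarith)]; linarith
  have b2 : |2 * t| ≤ 2 * T := by rw [abs_of_nonneg (by linarith)]; linarith
  have b3 : |-t| ≤ 2 * T := by rw [abs_neg, abs_of_nonneg ht0]; linarith
  have b4 : |t| ≤ 2 * T := by rw [abs_of_nonneg ht0]; linarith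
  have ea : 0 ≤ ‖cut T σ t‖ := norm_nonneg _
  have eb : 0 ≤ ‖cut T σ t‖ ^ 2 := by positivity
  have ee : 0 ≤ ‖chi T t‖ := norm_nonneg _
  have hK : 0 ≤ κ * ‖z‖ := by positivity
  have h3' : ‖z.2.2‖ ≤ κ * ‖z‖ := by nlinarith
  have q1 := mul_nonneg ea hK
  have q2 := mul_nonneg eb hK
  have q3 := mul_nonneg ee hK
  have hb : ‖Complex.I * cut T σ t ^ 2‖ = ‖cut T σ t‖ ^ 2 := by simp
  unfold dom
  rw [norm_prod_le_iff, norm_prod_le_iff]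
  refine ⟨(norm_add_le _ _).trans ?_, (norm_sub_le _ _).trans ?_, (norm_add_le _ _).trans ?_⟩
  · rw [norm_mul, norm_mul (Complex.I * _), hb]
    nlinarith [mul_le_mul_of_nonneg_left (w _ b1 _ h2) ea, mul_le_mul_of_nonneg_left (w _ b3 _ h3) eb]
  · rw [norm_mul, norm_mul (Complex.I * _), hb]
    nlinarith [mul_le_mul_of_nonneg_left (w _ b2 _ h1) ea, mul_le_mul_of_nonneg_left (w _ b4 _ h3) eb]
  · have h4 : ‖wave ρ t * z.1 - wave ρ (-t) * z.2.1‖ ≤ 2 * (κ * ‖z‖) := by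
      refine (norm_sub_le _ _).trans ?_
      linarith [w _ b4 _ h1, w _ b3 _ h2]
    rw [norm_mul, norm_mul, norm_mul, norm_half_I]
    nlinarith [mul_le_mul_of_nonneg_left h3' ea, mul_le_mul_of_nonneg_left h4 ee]

theorem integrableOn_mul_of_continuousOn {T : ℝ} {f g : ℝ → ℂ} (hf : Integrable f)
    (hg : ContinuousOn g (Icc 0 T)) : IntegrableOn (fun t => f t * g t) (Ioo 0 T) :=
  (hf.integrableOn.mul_continuousOn hg isCompact_Icc).mono_set Ioo_subset_Icc_self

theorem scal_integrableOn {T : ℝ} {σ c : ℝ → ℂ} (hσ : InL2 T σ) (hc : InL2 T c) (ρ : ℂ)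
    {Z : ℝ → ℂ × ℂ × ℂ} (hZ : ContinuousOn Z (Icc 0 T)) :
    IntegrableOn (fun t => scalLin T σ ρ t (Z t) + scalInh T c ρ t) (Ioo 0 T) := by
  have w := continuous_wave ρ
  have w1 : ContinuousOn (fun t => wave ρ t) (Icc 0 T) := w.continuousOn
  have w2 : ContinuousOn (fun t => wave ρ (-t)) (Icc 0 T) := (by fun_prop : Continuous _).continuousOn
  have w3 : ContinuousOn (fun t => wave ρ (2 * t)) (Icc 0 T) :=
    (by fun_prop : Continuous _).continuousOn
  have w4 : ContinuousOn (fun t => wave ρ (-(2 * t))) (Icc 0 T) :=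
    (by fun_prop : Continuous _).continuousOn
  have z1 : ContinuousOn (fun t => (Z t).1) (Icc 0 T) := hZ.fst
  have z2 : ContinuousOn (fun t => (Z t).2.1) (Icc 0 T) := hZ.snd.fst
  have z3 : ContinuousOn (fun t => (Z t).2.2) (Icc 0 T) := hZ.snd.snd
  have i1 := cut_integrable hσ
  have i2 := (cut_sq_integrable hσ).const_mul Complex.I
  have i3 := cut_integrable hc
  have i4 := (chi_integrable T).mul_const (Complex.I / 2)
  refine Integrable.prodMk ?_ (Integrable.prodMk ?_ ?_)
  · refine ((integrableOn_mul_of_continuousOn i1 (w4.mul z2)).add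
      (integrableOn_mul_of_continuousOn i2 (w2.mul z3))).add ?_
    simp only [scalInh, mul_comm (wave ρ _)]
    exact integrableOn_mul_of_continuousOn i3 w2
  · refine ((integrableOn_mul_of_continuousOn i1 (w3.mul z1)).sub
      (integrableOn_mul_of_continuousOn i2 (w1.mul z3))).add ?_
    simp only [scalInh, mul_comm (wave ρ _)]
    exact integrableOn_mul_of_continuousOn i3 w1
  · refine ((integrableOn_mul_of_continuousOn i1 z3).add
      (integrableOn_mul_of_continuousOn i4 ((w1.mul z1).sub (w2.mul z2)))).add ?_
    exact integrable_zero _ _ _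

theorem intervalIntegrable_of_integrableOn {E : Type*} [NormedAddCommGroup E] {T : ℝ} {f : ℝ → E}
    (hf : IntegrableOn f (Ioo 0 T)) {x : ℝ} (hx : x ∈ Icc 0 T) :
    IntervalIntegrable f volume 0 x :=
  (intervalIntegrable_iff_integrableOn_Ioo_of_le hx.1).2
    (hf.mono_set (Ioo_subset_Ioo_right hx.2))

/-- The integral equation for fixed `ρ`. -/
structure IsScal (T : ℝ) (σ c : ℝ → ℂ) (ρ : ℂ) (z₀ : ℂ × ℂ × ℂ) (Z : ℝ → ℂ × ℂ × ℂ) : Prop where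
  continuousOn : ContinuousOn Z (Icc 0 T)
  eqn : ∀ x ∈ Icc 0 T, Z x = z₀ + ∫ t in (0:ℝ)..x, (scalLin T σ ρ t (Z t) + scalInh T c ρ t)

theorem IsScal.unique {T : ℝ} {σ c : ℝ → ℂ} (hσ : InL2 T σ) (hc : InL2 T c) {ρ : ℂ}
    {z₀ : ℂ × ℂ × ℂ} {Z W : ℝ → ℂ × ℂ × ℂ} (hZ : IsScal T σ c ρ z₀ Z) (hW : IsScal T σ c ρ z₀ W) :
    ∀ x ∈ Icc 0 T, Z x = W x := by
  intro x hx
  have h := volterra_gronwall (a := fun t => Real.exp (‖ρ‖ * (2 * T)) * dom T σ t)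
    ((dom_integrable hσ).const_mul _) (fun t => mul_nonneg (Real.exp_pos _).le (dom_nonneg T σ t))
    (D := fun t => Z t - W t) (g := fun t => scalLin T σ ρ t (Z t - W t)) le_rfl
    (hZ.continuousOn.sub hW.continuousOn) (fun t ht => norm_scalLin_le σ ρ ht _) (fun t ht => ?_) x hx
  · rw [mul_zero, mul_zero] at h
    exact sub_eq_zero.1 (norm_le_zero_iff.1 h)
  · rw [hZ.eqn t ht, hW.eqn t ht, add_sub_add_left_eq_sub, ← intervalIntegral.integral_sub
      (intervalIntegrable_of_integrableOn (scal_integrableOn hσ hc ρ hZ.continuousOn) ht)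
      (intervalIntegrable_of_integrableOn (scal_integrableOn hσ hc ρ hW.continuousOn) ht)]
    simp only [scalLin_sub, add_sub_add_right_eq_sub, sub_self, norm_zero, le_refl]

/-- The transforms at `ρ` of a triple supported in `[-R, R]`. -/
noncomputable def fhat3 (ρ : ℂ) (R : ℝ) : Triple →L[ℝ] ℂ × ℂ × ℂ :=
  (((fhatCLM ρ R).restrictScalars ℝ).prodMap
    (((fhatCLM ρ R).restrictScalars ℝ).prodMap ((fhatCLM ρ R).restrictScalars ℝ)))

theorem fhat3_apply (ρ : ℂ) (R : ℝ) (h : Triple) :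
    fhat3 ρ R h = (fhatCLM ρ R h.1, fhatCLM ρ R h.2.1, fhatCLM ρ R h.2.2) := rfl

theorem fhatCLM_trans (ρ : ℂ) {R a b t : ℝ} {f : LineL2} (hf : f ∈ suppIn a b) (ha : -R ≤ a)
    (hb : b ≤ R) (hat : -R ≤ a + t) (hbt : b + t ≤ R) :
    fhatCLM ρ R (trans t f) = wave ρ t * fhatCLM ρ R f := by
  rw [fhatCLM_eq ρ (suppIn_mono hat hbt (trans_mem_suppIn rfl rfl hf)),
    fhatCLM_eq ρ (suppIn_mono ha hb hf), fhat_trans, wave]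

/-- The transform turns each translation into multiplication by a wave. The radius `2T` contains all
supports before and after the shifts. -/
theorem fhat3_kerOp {T : ℝ} (σ : ℝ → ℂ) (ρ : ℂ) {t : ℝ} (ht : t ∈ Icc 0 T) {h : Triple}
    (hh : h ∈ kerSupp t) :
    fhat3 ρ (2 * T) (kerOp T σ t h) = scalLin T σ ρ t (fhat3 ρ (2 * T) h) := by
  obtain ⟨h1, h2, h3⟩ := hh
  have ht0 := ht.1
  have htT := ht.2
  simp only [fhat3_apply, kerOp, scalLin, map_add, map_sub, map_smul, smul_eq_mul]
  rw [fhatCLM_trans ρ h2 (t := -(2 * t)), fhatCLM_trans ρ h3 (t := -t),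
    fhatCLM_trans ρ h1 (t := 2 * t), fhatCLM_trans ρ h3 (t := t), fhatCLM_trans ρ h1 (t := t),
    fhatCLM_trans ρ h2 (t := -t)] <;> linarith

theorem fhatCLM_src (ρ : ℂ) {m x R : ℝ} (hm : m ≠ 0) (hx : 0 ≤ x) (hR : |m| * x ≤ R) {f : ℝ → ℂ}
    (hf : MemLp f 2 volume) :
    fhatCLM ρ R (src m hf x) = ∫ t in (0:ℝ)..x, f t * wave ρ (m * t) := by
  rw [fhatCLM_eq ρ (src_mem_suppIn hm hf fun t ht => ?_), fhat_src ρ hm hx hf]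
  · refine intervalIntegral.integral_congr fun t _ => ?_
    simp only [wave]
    rw [mul_comm]
    congr 2
    push_cast
    ring
  · have h1 := abs_le.1 (le_refl (|m * t|))
    have h2 : |m * t| ≤ |m| * x := by
      rw [abs_mul, abs_of_pos ht.1]
      exact mul_le_mul_of_nonneg_left ht.2.le (abs_nonneg _)
    exact ⟨by linarith [h1.1], by linarith [h1.2]⟩

/-- The source is what the scalar equation produces from the constant initial value `(α, β, 0)`,
with each oscillating integral written as the transform of a density. The last entry `0` removes the
terms with `σ²`. -/
theorem fhat3_kerSrc {T : ℝ} {σ c : ℝ → ℂ} (hσ : InL2 T σ) (hc : InL2 T c) (α β ρ : ℂ) {x : ℝ}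
    (hx : x ∈ Icc 0 T) : fhat3 ρ (2 * T) (kerSrc T hσ hc α β x) =
      ∫ t in (0:ℝ)..x, (scalLin T σ ρ t (α, β, 0) + scalInh T c ρ t) := by
  have hx0 := hx.1
  have hxT := hx.2
  have hI := intervalIntegrable_of_integrableOn
    (scal_integrableOn hσ hc ρ (Z := fun _ => (α, β, 0)) continuousOn_const) hx
  have j (f : ℝ → ℂ) (hf : Integrable f) (m : ℝ) :
      IntervalIntegrable (fun t => f t * wave ρ (m * t)) volume 0 x :=
    intervalIntegrable_of_integrableOn (T := T) (integrableOn_mul_of_continuousOn hf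
      ((continuous_wave ρ).comp (continuous_const.mul continuous_id)).continuousOn) hx
  have i1 := j _ (cut_integrable hσ)
  have i2 := j _ (cut_integrable hc)
  have i3 := j _ (chi_integrable T)
  have e1 : ∀ t : ℝ, -t = -1 * t := fun t => by ring
  have e2 : ∀ t : ℝ, -(2 * t) = -2 * t := fun t => by ring
  refine Prod.ext ?_ (Prod.ext ?_ ?_)
  · rw [intervalIntegral_fst hI]
    simp only [fhat3_apply, kerSrc, map_add, map_smul, smul_eq_mul]
    rw [fhatCLM_src ρ (by norm_num) hx0 (by norm_num; linarith),
      fhatCLM_src ρ (by norm_num) hx0 (by norm_num; linarith),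
      ← intervalIntegral.integral_const_mul,
      ← intervalIntegral.integral_add ((i1 _).const_mul _) (i2 _)]
    refine intervalIntegral.integral_congr fun t _ => ?_
    simp only [scalLin, scalInh, Prod.fst_add, ← e1, ← e2]
    ring
  · rw [intervalIntegral_snd hI, intervalIntegral_fst (intervalIntegrable_snd hI)]
    simp only [fhat3_apply, kerSrc, map_add, map_smul, smul_eq_mul]
    rw [fhatCLM_src ρ (by norm_num) hx0 (by norm_num; linarith),
      fhatCLM_src ρ (by norm_num) hx0 (by norm_num; linarith),
      ← intervalIntegral.integral_const_mul,
      ← intervalIntegral.integral_add ((i1 _).const_mul _) (i2 _)]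
    refine intervalIntegral.integral_congr fun t _ => ?_
    simp only [scalLin, scalInh, Prod.fst_add, Prod.snd_add, one_mul]
    ring
  · rw [intervalIntegral_snd hI, intervalIntegral_snd (intervalIntegrable_snd hI)]
    simp only [fhat3_apply, kerSrc, map_sub, map_smul, smul_eq_mul]
    rw [fhatCLM_src ρ (by norm_num) hx0 (by norm_num; linarith),
      fhatCLM_src ρ (by norm_num) hx0 (by norm_num; linarith),
      ← intervalIntegral.integral_const_mul, ← intervalIntegral.integral_const_mul,
      ← intervalIntegral.integral_sub ((i3 _).const_mul _) ((i3 _).const_mul _),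
      ← intervalIntegral.integral_const_mul]
    refine intervalIntegral.integral_congr fun t _ => ?_
    simp only [scalLin, scalInh, Prod.snd_add, ← e1, one_mul]
    ring

theorem IsKernel.isScal {T : ℝ} {σ c : ℝ → ℂ} {hσ : InL2 T σ} {hc : InL2 T c} {α β : ℂ}
    {Y : ℝ → Triple} (hY : IsKernel T hσ hc α β Y) (ρ : ℂ) :
    IsScal T σ c ρ (α, β, 0) fun x => (α, β, 0) + fhat3 ρ (2 * T) (Y x) := by
  have hcont : Continuous fun x => fhat3 ρ (2 * T) (Y x) :=
    (fhat3 ρ (2 * T)).continuous.comp hY.continuous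
  refine ⟨(continuous_const.add hcont).continuousOn, fun x hx => ?_⟩
  have hI := (kerOp_isVolterra hσ).intervalIntegrable hY.continuous 0 x
  have hJ := intervalIntegrable_of_integrableOn
    (scal_integrableOn hσ hc ρ (Z := fun _ => (α, β, 0)) continuousOn_const) hx
  have hI' : IntervalIntegrable (fun t => fhat3 ρ (2 * T) (kerOp T σ t (Y t))) volume 0 x :=
    ⟨(fhat3 ρ (2 * T)).integrable_comp hI.1, (fhat3 ρ (2 * T)).integrable_comp hI.2⟩
  conv_lhs => rw [hY.eqn x hx, map_add, fhat3_kerSrc hσ hc α β ρ hx,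
    ← (fhat3 ρ (2 * T)).intervalIntegral_comp_comm hI,
    ← intervalIntegral.integral_add hJ hI']
  congr 1
  refine intervalIntegral.integral_congr fun t ht => ?_
  rw [uIcc_of_le hx.1] at ht
  have ht' : t ∈ Icc 0 T := ⟨ht.1, ht.2.trans hx.2⟩
  rw [fhat3_kerOp σ ρ ht' (hY.mem t ht'), scalLin_add]
  abel

/-! ### From the differential equation to the scalar integral equation. -/

theorem ac_eq_integral {T : ℝ} (hT : 0 < T) {f g : ℝ → ℂ}
    (hf : AbsolutelyContinuousOnInterval f 0 T) (hg : IntegrableOn g (Ioo 0 T))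
    (hd : ∀ᵐ x ∂volume.restrict (Ioo 0 T), HasDerivAt f (g x) x) {x : ℝ} (hx : x ∈ Icc 0 T) :
    f x = f 0 + ∫ t in (0:ℝ)..x, g t := by
  have hg' : Integrable ((Ioo 0 T).indicator g) := hg.integrable_indicator measurableSet_Ioo
  rw [eq_primitive hT hf (f' := (Ioo 0 T).indicator g) (fun _ _ => hg'.intervalIntegrable) (by
    filter_upwards [hd, ae_restrict_mem measurableSet_Ioo] with t ht hm
    rwa [indicator_of_mem hm]) hx]
  rw [intervalIntegral.integral_of_le hx.1, intervalIntegral.integral_of_le hx.1,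
    integral_Ioc_eq_integral_Ioo, integral_Ioc_eq_integral_Ioo]
  congr 1
  refine setIntegral_congr_fun measurableSet_Ioo fun t ht => ?_
  exact indicator_of_mem (show t ∈ Ioo 0 T from ⟨ht.1, ht.2.trans_le hx.2⟩) _

/-- The first-order system with the regularized quasi-derivative `v` and quotient `u`. -/
structure IsModSol (T : ℝ) (σ c : ℝ → ℂ) (ρ : ℂ) (y v u : ℝ → ℂ) : Prop where
  ac_y : AbsolutelyContinuousOnInterval y 0 T
  ac_v : AbsolutelyContinuousOnInterval v 0 T
  ac_u : AbsolutelyContinuousOnInterval u 0 T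
  deriv_y : ∀ᵐ x ∂volume.restrict (Ioo 0 T), HasDerivAt y (σ x * y x + ρ * v x + c x) x
  deriv_v : ∀ᵐ x ∂volume.restrict (Ioo 0 T),
    HasDerivAt v (-ρ * y x - σ x * v x - σ x ^ 2 * u x) x
  deriv_u : ∀ᵐ x ∂volume.restrict (Ioo 0 T), HasDerivAt u (σ x * u x + v x) x
  u_zero : u 0 = 0

theorem IsModSol.isScal {T : ℝ} (hT : 0 < T) {σ c : ℝ → ℂ} (hσ : InL2 T σ) (hc : InL2 T c) {ρ : ℂ}
    {y v u : ℝ → ℂ} (h : IsModSol T σ c ρ y v u) :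
    IsScal T σ c ρ (y 0 - Complex.I * v 0, y 0 + Complex.I * v 0, 0) fun x =>
      (wave ρ (-x) * (y x - Complex.I * v x), wave ρ x * (y x + Complex.I * v x), u x) := by
  have hv : AbsolutelyContinuousOnInterval (fun x => Complex.I * v x) 0 T :=
    h.ac_v.const_smul Complex.I
  have hp : AbsolutelyContinuousOnInterval
      (fun x => wave ρ (-x) * (y x - Complex.I * v x)) 0 T := by
    have := (ac_wave ρ (-1) T).smul (h.ac_y.sub hv)
    simp only [neg_one_mul] at this
    exact this
  have hq : AbsolutelyContinuousOnInterval
      (fun x => wave ρ x * (y x + Complex.I * v x)) 0 T := by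
    have := (ac_wave ρ 1 T).smul (h.ac_y.add hv)
    simp only [one_mul] at this
    exact this
  have w1 (x : ℝ) : HasDerivAt (fun x => wave ρ (-x)) (-(Complex.I * ρ) * wave ρ (-x)) x := by
    have := hasDerivAt_wave ρ (-1) x
    simpa using this
  have w2 (x : ℝ) : HasDerivAt (fun x => wave ρ x) (Complex.I * ρ * wave ρ x) x := by
    have := hasDerivAt_wave ρ 1 x
    simpa using this
  have wd (x : ℝ) : wave ρ (-(2 * x)) = wave ρ (-x) * wave ρ (-x) := by
    rw [← wave_add]; congr 1; ring
  have wd' (x : ℝ) : wave ρ (2 * x) = wave ρ x * wave ρ x := by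
    rw [← wave_add]; congr 1; ring
  have hZ : ContinuousOn (fun x =>
      (wave ρ (-x) * (y x - Complex.I * v x), wave ρ x * (y x + Complex.I * v x), u x))
      (Icc 0 T) := by
    rw [← uIcc_of_le hT.le]
    exact hp.continuousOn.prodMk (hq.continuousOn.prodMk h.ac_u.continuousOn)
  have hG := scal_integrableOn hσ hc ρ hZ
  have I2 : Complex.I * Complex.I = -1 := Complex.I_mul_I
  refine ⟨hZ, fun x hx => ?_⟩
  have hI := intervalIntegrable_of_integrableOn hG hx
  refine Prod.ext ?_ (Prod.ext ?_ ?_)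
  · rw [Prod.fst_add, intervalIntegral_fst hI]
    refine (ac_eq_integral hT hp hG.fst ?_ hx).trans (by simp [wave_zero])
    filter_upwards [h.deriv_y, h.deriv_v, ae_restrict_mem measurableSet_Ioo] with t h1 h2 ht
    -- The wave is the integrating factor: its derivative cancels the terms `ρv` and `iρy`, so `ρ`
    -- is left only in exponentials.
    refine ((w1 t).mul (h1.sub (h2.const_mul Complex.I))).congr_deriv ?_
    simp only [scalLin, scalInh, cut, chi, indicator_of_mem ht, Prod.fst_add, wd, Pi.sub_apply]
    linear_combination (-(σ t * wave ρ (-t)) * (y t + Complex.I * v t)) * wave_neg_mul ρ t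
      + (ρ * v t * wave ρ (-t)) * I2
  · rw [Prod.snd_add, Prod.fst_add, intervalIntegral_snd hI,
      intervalIntegral_fst (intervalIntegrable_snd hI)]
    refine (ac_eq_integral hT hq hG.snd.fst ?_ hx).trans (by simp [wave_zero])
    filter_upwards [h.deriv_y, h.deriv_v, ae_restrict_mem measurableSet_Ioo] with t h1 h2 ht
    refine ((w2 t).mul (h1.add (h2.const_mul Complex.I))).congr_deriv ?_
    simp only [scalLin, scalInh, cut, chi, indicator_of_mem ht, Prod.fst_add, Prod.snd_add, wd',
      Pi.add_apply]
    linear_combination (-(σ t * wave ρ t) * (y t - Complex.I * v t)) * wave_neg_mul ρ t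
      + (ρ * v t * wave ρ t) * I2
  · rw [Prod.snd_add, Prod.snd_add, intervalIntegral_snd hI,
      intervalIntegral_snd (intervalIntegrable_snd hI)]
    refine (ac_eq_integral hT h.ac_u hG.snd.snd ?_ hx).trans (by simp [h.u_zero])
    filter_upwards [h.deriv_u, ae_restrict_mem measurableSet_Ioo] with t h1 ht
    refine h1.congr_deriv ?_
    simp only [scalLin, scalInh, cut, chi, indicator_of_mem ht, Prod.snd_add]
    linear_combination (-(Complex.I / 2) * (y t - Complex.I * v t)
      + (Complex.I / 2) * (y t + Complex.I * v t)) * wave_neg_mul ρ t + v t * I2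

/-- The kernel of `y`. -/
noncomputable def yKer (Y : ℝ → Triple) (x : ℝ) : LineL2 :=
  (1 / 2 : ℂ) • (trans x (Y x).1 + trans (-x) (Y x).2.1)

/-- The kernel of `v`. -/
noncomputable def vKer (Y : ℝ → Triple) (x : ℝ) : LineL2 :=
  (Complex.I / 2) • (trans x (Y x).1 - trans (-x) (Y x).2.1)

section
variable {T : ℝ} {σ c : ℝ → ℂ} {hσ : InL2 T σ} {hc : InL2 T c} {α β : ℂ} {Y : ℝ → Triple} {x : ℝ}

/-- Undoing the integrating factors shifts `[-2x, 0]` by `x` and `[0, 2x]` by `-x`, both onto `[-x,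
x]`. -/
theorem IsKernel.yKer_mem (hY : IsKernel T hσ hc α β Y) (hx : x ∈ Icc 0 T) :
    yKer Y x ∈ suppIn (-x) x := by
  obtain ⟨h1, h2, -⟩ := hY.mem x hx
  exact smul_mem_suppIn _ (add_mem (trans_mem_suppIn (by ring) (by ring) h1)
    (trans_mem_suppIn (by ring) (by ring) h2))

theorem IsKernel.vKer_mem (hY : IsKernel T hσ hc α β Y) (hx : x ∈ Icc 0 T) :
    vKer Y x ∈ suppIn (-x) x := by
  obtain ⟨h1, h2, -⟩ := hY.mem x hx
  exact smul_mem_suppIn _ (sub_mem (trans_mem_suppIn (by ring) (by ring) h1)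
    (trans_mem_suppIn (by ring) (by ring) h2))

theorem cos_eq_wave (ρ : ℂ) (x : ℝ) : Complex.cos (ρ * x) = (wave ρ x + wave ρ (-x)) / 2 := by
  rw [Complex.cos, wave, wave]
  congr 3 <;> push_cast <;> ring

theorem sin_eq_wave (ρ : ℂ) (x : ℝ) :
    Complex.sin (ρ * x) = (wave ρ (-x) - wave ρ x) * Complex.I / 2 := by
  rw [Complex.sin, wave, wave]
  congr 4 <;> push_cast <;> ring

theorem IsModSol.representation (hT : 0 < T) {ρ : ℂ} {y v u : ℝ → ℂ}
    (h : IsModSol T σ c ρ y v u)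
    (hY : IsKernel T hσ hc (y 0 - Complex.I * v 0) (y 0 + Complex.I * v 0) Y) (hx : x ∈ Icc 0 T) :
    y x = y 0 * Complex.cos (ρ * x) + v 0 * Complex.sin (ρ * x) + fhat ρ (yKer Y x) ∧
    v x = -y 0 * Complex.sin (ρ * x) + v 0 * Complex.cos (ρ * x) + fhat ρ (vKer Y x) := by
  have hx0 := hx.1
  have hxT := hx.2
  -- The differential equation and the transformed kernels solve the same scalar equation, hence
  -- coincide.
  have e := (h.isScal hT hσ hc).unique hσ hc (hY.isScal ρ) x hx
  have e1 := congrArg Prod.fst e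
  have e2 := congrArg (fun z : ℂ × ℂ × ℂ => z.2.1) e
  simp only [fhat3_apply, Prod.fst_add, Prod.snd_add] at e1 e2
  obtain ⟨h1, h2, -⟩ := hY.mem x hx
  have t1 := fhatCLM_trans ρ (R := 2 * T) h1 (t := x) (by linarith) (by linarith) (by linarith)
    (by linarith)
  have t2 := fhatCLM_trans ρ (R := 2 * T) h2 (t := -x) (by linarith) (by linarith) (by linarith)
    (by linarith)
  have k1 := fhatCLM_eq ρ (suppIn_mono (c := -(2 * T)) (d := 2 * T) (by linarith) (by linarith)
    (hY.yKer_mem hx))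
  have k2 := fhatCLM_eq ρ (suppIn_mono (c := -(2 * T)) (d := 2 * T) (by linarith) (by linarith)
    (hY.vKer_mem hx))
  rw [yKer, map_smul, map_add, smul_eq_mul, ← yKer, t1, t2] at k1
  rw [vKer, map_smul, map_sub, smul_eq_mul, ← vKer, t1, t2] at k2
  have w := wave_neg_mul ρ x
  have I2 : Complex.I * Complex.I = -1 := Complex.I_mul_I
  have p1 : y x - Complex.I * v x = wave ρ x * (y 0 - Complex.I * v 0)
      + wave ρ x * fhatCLM ρ (2 * T) (Y x).1 := by
    linear_combination wave ρ x * e1 - (y x - Complex.I * v x) * w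
  have p2 : y x + Complex.I * v x = wave ρ (-x) * (y 0 + Complex.I * v 0)
      + wave ρ (-x) * fhatCLM ρ (2 * T) (Y x).2.1 := by
    linear_combination wave ρ (-x) * e2 - (y x + Complex.I * v x) * w
  rw [← k1, ← k2, cos_eq_wave, sin_eq_wave]
  constructor
  · linear_combination (1 / 2) * p1 + (1 / 2) * p2
  · linear_combination (Complex.I / 2) * p1 - (Complex.I / 2) * p2
      - ((wave ρ x + wave ρ (-x)) * v 0 / 2 - v x) * I2

end

theorem IsSolution.hasDerivAt {T : ℝ} {σ : ℝ → ℂ} {lam : ℂ} {y y₁ : ℝ → ℂ}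
    (h : IsSolution T σ lam y y₁) : ∀ᵐ x ∂volume.restrict (Ioo 0 T),
      HasDerivAt y (σ x * y x + y₁ x) x ∧
      HasDerivAt y₁ (-(σ x ^ 2 + lam) * y x - σ x * y₁ x) x := by
  filter_upwards [h.quasi, h.eqn] with x ⟨d, hd, e⟩ ⟨d', hd', e'⟩
  exact ⟨hd.congr_deriv (by rw [e]; ring), hd'.congr_deriv (by linear_combination -e')⟩

theorem isModSol_sol {T : ℝ} {σ : ℝ → ℂ} {ρ : ℂ} {y y₁ : ℝ → ℂ}
    (h : IsSolution T σ (ρ ^ 2) y y₁) (h0 : y 0 = 0) :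
    IsModSol T σ 0 ρ (fun x => ρ * y x) y₁ y where
  ac_y := h.ac.const_smul ρ
  ac_v := h.ac_quasi
  ac_u := h.ac
  deriv_y := h.hasDerivAt.mono fun x hx =>
    (hx.1.const_mul ρ).congr_deriv (by simp only [Pi.zero_apply]; ring)
  deriv_v := h.hasDerivAt.mono fun x hx => hx.2.congr_deriv (by ring)
  deriv_u := h.hasDerivAt.mono fun x hx => hx.1
  u_zero := h0

/-- Subtracting the solution at `λ = 0` gives `u` and `v` the initial values needed and moves its
quasi-derivative into the forcing term. At `ρ = 0` both quotients are `0` by the convention for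
division, and the system still holds because `hyz` makes the two solutions equal. -/
theorem isModSol_phi {T : ℝ} {σ : ℝ → ℂ} {ρ : ℂ} {y y₁ z z₁ : ℝ → ℂ}
    (h : IsSolution T σ (ρ ^ 2) y y₁) (hz : IsSolution T σ 0 z z₁) (h0 : y 0 = z 0)
    (hyz : ρ = 0 → y = z ∧ y₁ = z₁) :
    IsModSol T σ z₁ ρ y (fun x => (y₁ x - z₁ x) / ρ) (fun x => (y x - z x) / ρ) where
  ac_y := h.ac
  ac_v := by
    have := (h.ac_quasi.sub hz.ac_quasi).const_smul ρ⁻¹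
    convert! this using 2
    simp only [Pi.sub_apply, smul_eq_mul]; ring
  ac_u := by
    have := (h.ac.sub hz.ac).const_smul ρ⁻¹
    convert! this using 2
    simp only [Pi.sub_apply, smul_eq_mul]; ring
  deriv_y := h.hasDerivAt.mono fun x hx => hx.1.congr_deriv (by
    rcases eq_or_ne ρ 0 with hρ | hρ
    · rw [(hyz hρ).2]; simp
    · field_simp; ring)
  deriv_v := by
    filter_upwards [h.hasDerivAt, hz.hasDerivAt] with x h1 h2
    refine ((h1.2.sub h2.2).div_const ρ).congr_deriv ?_
    rcases eq_or_ne ρ 0 with hρ | hρ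
    · simp [hρ]
    · field_simp; ring
  deriv_u := by
    filter_upwards [h.hasDerivAt, hz.hasDerivAt] with x h1 h2
    refine ((h1.1.sub h2.1).div_const ρ).congr_deriv ?_
    rcases eq_or_ne ρ 0 with hρ | hρ
    · simp [hρ]
    · field_simp; ring
  u_zero := by simp [h0]

/-! ### Bounds and Lipschitz estimates depending only on `Ω` and `T`. -/

theorem InL2.mono {x T : ℝ} {f : ℝ → ℂ} (hf : InL2 T f) (hx : x ≤ T) : InL2 x f :=
  MemLp.mono_measure (Measure.restrict_mono (Ioo_subset_Ioo_right hx) le_rfl) hf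

theorem normOn_mono {x T : ℝ} (f : ℝ → ℂ) (hx : x ≤ T) : normOn x f ≤ normOn T f :=
  eLpNorm_mono_measure _ (Measure.restrict_mono (Ioo_subset_Ioo_right hx) le_rfl)

theorem normOn_toReal_mono {x T : ℝ} {f : ℝ → ℂ} (hf : InL2 T f) (hx : x ≤ T) :
    (normOn x f).toReal ≤ (normOn T f).toReal :=
  ENNReal.toReal_mono hf.2.ne (normOn_mono f hx)

theorem normOn_cut {x T : ℝ} (hx : x ≤ T) (f : ℝ → ℂ) : normOn x (cut T f) = normOn x f := by
  refine eLpNorm_congr_ae ?_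
  filter_upwards [ae_restrict_mem measurableSet_Ioo] with t ht
  exact indicator_of_mem (show t ∈ Ioo 0 T from ⟨ht.1, ht.2.trans_le hx⟩) _

theorem cut_sub (T : ℝ) (f g : ℝ → ℂ) : cut T f - cut T g = cut T (f - g) :=
  (indicator_sub' _ f g).symm

theorem integral_norm_mul_le {x : ℝ} (hx : 0 ≤ x) {f g : ℝ → ℂ} (hf : InL2 x f) (hg : InL2 x g) :
    ∫ t in (0:ℝ)..x, ‖f t‖ * ‖g t‖ ≤ (normOn x f).toReal * (normOn x g).toReal := by
  have h1 : eLpNorm (f • g) 1 (volume.restrict (Ioo 0 x)) ≤ normOn x f * normOn x g :=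
    eLpNorm_smul_le_mul_eLpNorm hg.1 hf.1
  rw [smul_eq_mul] at h1
  have h2 : MemLp (f * g) 1 (volume.restrict (Ioo 0 x)) :=
    memLp_one_iff_integrable.2 (hf.integrable_mul hg)
  rw [intervalIntegral.integral_of_le hx, integral_Ioc_eq_integral_Ioo, ← ENNReal.toReal_mul]
  refine le_trans (le_of_eq ?_) (ENNReal.toReal_mono (ENNReal.mul_ne_top hf.2.ne hg.2.ne) h1)
  rw [eLpNorm_one_eq_lintegral_enorm, ← integral_norm_eq_lintegral_enorm h2.1]
  exact integral_congr_ae (Eventually.of_forall fun t => (norm_mul _ _).symm)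

theorem normOn_le_of_bound {x M : ℝ} (hx : 0 ≤ x) (hM : 0 ≤ M) {f : ℝ → ℂ}
    (h : ∀ t ∈ Ioo 0 x, ‖f t‖ ≤ M) : (normOn x f).toReal ≤ √x * M := by
  have h1 := eLpNorm_le_of_ae_bound (p := 2)
    ((ae_restrict_mem (μ := (volume : Measure ℝ)) measurableSet_Ioo).mono h)
  refine (ENNReal.toReal_mono (by finiteness) h1).trans (le_of_eq ?_)
  rw [ENNReal.toReal_mul, ENNReal.toReal_ofReal hM, ← ENNReal.toReal_rpow]
  simp [Real.sqrt_eq_rpow, hx]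

theorem chi_inL2 (T x : ℝ) : InL2 x (chi T) := (chi_memLp T).restrict _

theorem normOn_chi_le {T x : ℝ} (hx : x ∈ Icc 0 T) : (normOn x (chi T)).toReal ≤ √T := by
  refine (normOn_le_of_bound hx.1 zero_le_one fun t _ => norm_chi_le T t).trans ?_
  rw [mul_one]
  exact Real.sqrt_le_sqrt hx.2

theorem cut_inL2 {T x : ℝ} {f : ℝ → ℂ} (hf : InL2 T f) : InL2 x (cut T f) := (cut_memLp hf).restrict _

theorem integral_norm_cut_le {T x : ℝ} (hx : x ∈ Icc 0 T) {f : ℝ → ℂ} (hf : InL2 T f) :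
    ∫ t in (0:ℝ)..x, ‖cut T f t‖ ≤ √T * (normOn x f).toReal := by
  have h := integral_norm_mul_le hx.1 (cut_inL2 hf) (chi_inL2 T x)
  rw [normOn_cut hx.2] at h
  have e : ∀ t, ‖cut T f t‖ * ‖chi T t‖ = ‖cut T f t‖ := fun t => by
    simp only [cut, chi, indicator]; split_ifs <;> simp
  simp only [e] at h
  refine h.trans ?_
  rw [mul_comm]
  exact mul_le_mul_of_nonneg_right (normOn_chi_le hx) ENNReal.toReal_nonneg

theorem integral_dom_le {T x Ω : ℝ} (hx : x ∈ Icc 0 T) {σ : ℝ → ℂ} (hσ : InL2 T σ)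
    (hΩ : (normOn T σ).toReal ≤ Ω) : ∫ t in (0:ℝ)..x, dom T σ t ≤ √T * Ω + Ω ^ 2 + T := by
  have hn : (normOn x σ).toReal ≤ Ω := (normOn_toReal_mono hσ hx.2).trans hΩ
  have h0 : 0 ≤ (normOn x σ).toReal := ENNReal.toReal_nonneg
  have i1 : IntervalIntegrable (fun t => ‖cut T σ t‖) volume 0 x :=
    (cut_integrable hσ).norm.intervalIntegrable
  have i2 : IntervalIntegrable (fun t => ‖cut T σ t‖ ^ 2) volume 0 x :=
    ((cut_sq_integrable hσ).norm.congr
      (Eventually.of_forall fun t => norm_pow _ _)).intervalIntegrable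
  have i3 : IntervalIntegrable (fun t => ‖chi T t‖) volume 0 x :=
    (chi_integrable T).norm.intervalIntegrable
  unfold dom
  rw [intervalIntegral.integral_add (i1.add i2) i3, intervalIntegral.integral_add i1 i2]
  have h1 := integral_norm_cut_le hx hσ
  have h2 := integral_norm_mul_le hx.1 (cut_inL2 (x := x) hσ) (cut_inL2 (x := x) hσ)
  rw [normOn_cut hx.2] at h2
  simp only [← pow_two] at h2
  have h3 : ∫ t in (0:ℝ)..x, ‖chi T t‖ ≤ ∫ t in (0:ℝ)..x, (1:ℝ) :=
    intervalIntegral.integral_mono_on hx.1 i3 (by simp) fun t _ => norm_chi_le T t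
  rw [intervalIntegral.integral_const, smul_eq_mul, mul_one, sub_zero] at h3
  have h4 := mul_le_mul_of_nonneg_left hn (Real.sqrt_nonneg T)
  have h5 : (normOn x σ).toReal ^ 2 ≤ Ω ^ 2 := by gcongr
  linarith [hx.2]

/-- The bound of the weight of `σ` on `[0, T]` when `‖σ‖ ≤ Ω`. -/
noncomputable def growthBound (T Ω : ℝ) : ℝ := Real.exp (2 * (√T * Ω + Ω ^ 2 + T))

theorem growth_le {T x Ω : ℝ} (hx : x ∈ Icc 0 T) {σ : ℝ → ℂ} (hσ : InL2 T σ)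
    (hΩ : (normOn T σ).toReal ≤ Ω) : growth (dom T σ) x ≤ growthBound T Ω :=
  Real.exp_le_exp.2 (mul_le_mul_of_nonneg_left (integral_dom_le hx hσ hΩ) zero_le_two)

theorem growthBound_pos (T Ω : ℝ) : 0 < growthBound T Ω := Real.exp_pos _

/-- Write `σ² - τ² = (σ - τ)(σ + τ)` and apply the Cauchy–Schwarz inequality: the two factors `Ω`
come from `σ + τ`, and `√T` from comparing `L¹` with `L²`. -/
theorem integral_domDiff_le {T x Ω : ℝ} (hx : x ∈ Icc 0 T) {σ τ : ℝ → ℂ} (hσ : InL2 T σ)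
    (hτ : InL2 T τ) (hΩ : (normOn T σ).toReal ≤ Ω) (hΩ' : (normOn T τ).toReal ≤ Ω) :
    ∫ t in (0:ℝ)..x, domDiff T σ τ t ≤ (√T + 2 * Ω) * (normOn x (σ - τ)).toReal := by
  have hd : InL2 T (σ - τ) := MemLp.sub hσ hτ
  have hn : (normOn x σ).toReal ≤ Ω := (normOn_toReal_mono hσ hx.2).trans hΩ
  have hn' : (normOn x τ).toReal ≤ Ω := (normOn_toReal_mono hτ hx.2).trans hΩ'
  have h1 := integral_norm_cut_le hx hd
  have h2 := integral_norm_mul_le hx.1 (cut_inL2 (x := x) hd) (cut_inL2 (x := x) hσ)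
  have h3 := integral_norm_mul_le hx.1 (cut_inL2 (x := x) hd) (cut_inL2 (x := x) hτ)
  rw [normOn_cut hx.2, normOn_cut hx.2] at h2 h3
  have i1 : IntervalIntegrable (fun t => ‖cut T (σ - τ) t‖) volume 0 x :=
    (cut_integrable hd).norm.intervalIntegrable
  have i2 : IntervalIntegrable (fun t => ‖cut T (σ - τ) t‖ * ‖cut T σ t‖) volume 0 x := by
    refine Integrable.intervalIntegrable ?_
    exact (((cut_memLp hd).integrable_mul (cut_memLp hσ)).norm).congr
      (Eventually.of_forall fun t => norm_mul _ _)
  have i3 : IntervalIntegrable (fun t => ‖cut T (σ - τ) t‖ * ‖cut T τ t‖) volume 0 x := by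
    refine Integrable.intervalIntegrable ?_
    exact (((cut_memLp hd).integrable_mul (cut_memLp hτ)).norm).congr
      (Eventually.of_forall fun t => norm_mul _ _)
  have h4 : ∫ t in (0:ℝ)..x, domDiff T σ τ t ≤ ∫ t in (0:ℝ)..x, (‖cut T (σ - τ) t‖ +
      ‖cut T (σ - τ) t‖ * ‖cut T σ t‖ + ‖cut T (σ - τ) t‖ * ‖cut T τ t‖) := by
    refine intervalIntegral.integral_mono_on hx.1 (domDiff_integrable hσ hτ).intervalIntegrable
      ((i1.add i2).add i3) fun t _ => ?_
    have e : cut T σ t - cut T τ t = cut T (σ - τ) t := congrFun (cut_sub T σ τ) t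
    rw [domDiff, sq_sub_sq, norm_mul, e]
    nlinarith [norm_add_le (cut T σ t) (cut T τ t), norm_nonneg (cut T (σ - τ) t)]
  rw [intervalIntegral.integral_add (i1.add i2) i3, intervalIntegral.integral_add i1 i2] at h4
  have h0 : 0 ≤ (normOn x (σ - τ)).toReal := ENNReal.toReal_nonneg
  nlinarith [mul_le_mul_of_nonneg_left hn h0, mul_le_mul_of_nonneg_left hn' h0]

theorem norm_sysMat_aux (a b e : ℂ) (Y : ℂ × ℂ) :
    ‖((a * Y.1 + e * Y.2, -b * Y.1 - a * Y.2) : ℂ × ℂ)‖ ≤ (‖a‖ + ‖b‖ + ‖e‖) * ‖Y‖ := by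
  have h1 := norm_fst_le Y
  have h2 := norm_snd_le Y
  have ha := norm_nonneg a
  have hb := norm_nonneg b
  have he := norm_nonneg e
  have hY := norm_nonneg Y
  rw [norm_prod_le_iff]
  refine ⟨(norm_add_le _ _).trans ?_, (norm_sub_le _ _).trans ?_⟩
  · rw [norm_mul, norm_mul]
    nlinarith [mul_le_mul_of_nonneg_left h1 ha, mul_le_mul_of_nonneg_left h2 he, mul_nonneg hb hY]
  · rw [norm_mul, norm_mul, norm_neg]
    nlinarith [mul_le_mul_of_nonneg_left h1 hb, mul_le_mul_of_nonneg_left h2 ha, mul_nonneg he hY]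

theorem sysMat_zero_apply (T : ℝ) (σ : ℝ → ℂ) (t : ℝ) (Y : ℂ × ℂ) : sysMat T σ 0 t Y =
    (cut T σ t * Y.1 + chi T t * Y.2, -cut T σ t ^ 2 * Y.1 - cut T σ t * Y.2) := by
  by_cases ht : t ∈ Ioo 0 T
  · rw [sysMat_apply ht]
    simp [cut, chi, ht, pow_two]
  · rw [sysMat, indicator_of_notMem ht]
    simp [cut, chi, ht, Prod.ext_iff]

theorem sysMat_isVolterra {T : ℝ} {σ : ℝ → ℂ} (hσ : InL2 T σ) :
    IsVolterra (dom T σ) (fun t (Y : ℂ × ℂ) => sysMat T σ 0 t Y) where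
  integrable := dom_integrable hσ
  nonneg := dom_nonneg T σ
  map_sub t u v := map_sub _ _ _
  norm_le t u := by
    have := norm_sysMat_aux (cut T σ t) (cut T σ t ^ 2) (chi T t) u
    rwa [norm_pow, ← sysMat_zero_apply] at this
  meas Z hZ := isBoundedBilinearMap_apply.continuous.comp_aestronglyMeasurable
    ((sysMat_integrable hσ 0).1.prodMk hZ.aestronglyMeasurable)

theorem norm_sysMat_sub_le (T : ℝ) (σ τ : ℝ → ℂ) (t : ℝ) (Y : ℂ × ℂ) :
    ‖sysMat T σ 0 t Y - sysMat T τ 0 t Y‖ ≤ domDiff T σ τ t * ‖Y‖ := by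
  have := norm_sysMat_aux (cut T σ t - cut T τ t) (cut T σ t ^ 2 - cut T τ t ^ 2) 0 Y
  rw [norm_zero, add_zero] at this
  refine le_trans (le_of_eq (congrArg _ ?_)) this
  rw [sysMat_zero_apply, sysMat_zero_apply]
  refine Prod.ext ?_ ?_ <;> simp only [Prod.fst_sub, Prod.snd_sub] <;> ring

theorem IsSolution.exists_continuous {T : ℝ} (hT : 0 < T) {σ : ℝ → ℂ} (hσ : InL2 T σ) {lam : ℂ}
    {y y₁ : ℝ → ℂ} (h : IsSolution T σ lam y y₁) : ∃ D : ℝ → ℂ × ℂ, Continuous D ∧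
      ∀ x ∈ Icc 0 T, D x = (y x, y₁ x) ∧
        D x = (y 0, y₁ 0) + ∫ t in (0:ℝ)..x, sysMat T σ lam t (D t) := by
  have c1 := h.ac.continuousOn
  have c2 := h.ac_quasi.continuousOn
  rw [uIcc_of_le hT.le] at c1 c2
  have hc : ContinuousOn (fun x => (y x, y₁ x)) (Icc 0 T) := c1.prodMk c2
  let D : ℝ → ℂ × ℂ := IccExtend hT.le ((Icc 0 T).domRestrict fun x => (y x, y₁ x))
  have hD : Continuous D := (continuousOn_iff_continuous_domRestrict.1 hc).Icc_extend'
  have hDe (x : ℝ) (hx : x ∈ Icc 0 T) : D x = (y x, y₁ x) := by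
    simp only [D]; rw [IccExtend_of_mem _ _ hx]; rfl
  have hI := intervalIntegrable_apply (sysMat_integrable hσ lam) hD
  refine ⟨D, hD, fun x hx => ⟨hDe x hx, ?_⟩⟩
  rw [hDe x hx]
  have hI' := (intervalIntegrable_iff_integrableOn_Ioo_of_le hT.le).1 (hI 0 T)
  refine Prod.ext ?_ ?_
  · rw [Prod.fst_add, intervalIntegral_fst (hI 0 x)]
    refine ac_eq_integral hT h.ac hI'.fst ?_ hx
    filter_upwards [h.hasDerivAt, ae_restrict_mem measurableSet_Ioo] with t h1 hm
    rw [sysMat_apply hm, hDe t (Ioo_subset_Icc_self hm)]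
    exact h1.1
  · rw [Prod.snd_add, intervalIntegral_snd (hI 0 x)]
    refine ac_eq_integral hT h.ac_quasi hI'.snd ?_ hx
    filter_upwards [h.hasDerivAt, ae_restrict_mem measurableSet_Ioo] with t h1 hm
    rw [sysMat_apply hm, hDe t (Ioo_subset_Icc_self hm)]
    refine h1.2.congr_deriv ?_
    ring

/-- At `λ = 0` the pair `(φ, φ^{[1]})` itself solves a Volterra equation with dominating function
`dom T σ` and initial vector of norm `1`, so the same estimates control `c`, the forcing term for
`φ`. -/
theorem cFun_bounds {T Ω : ℝ} (hT : 0 < T) {σ : ℝ → ℂ} (hσ : InL2 T σ)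
    (hΩ : (normOn T σ).toReal ≤ Ω) :
    ∃ D : ℝ → ℂ × ℂ, Continuous D ∧ (∀ x ∈ Icc 0 T, (D x).2 = cFun T σ x ∧
      ‖D x‖ ≤ growthBound T Ω * 2 ∧
      D x = (1, 0) + ∫ t in (0:ℝ)..x, sysMat T σ 0 t (D t)) := by
  obtain ⟨hs, h1, h0⟩ := cauchySol_spec hT hσ 0 1 0
  obtain ⟨D, hD, hDe⟩ := hs.exists_continuous hT hσ
  rw [h1, h0] at hDe
  refine ⟨D, hD, fun x hx => ⟨by rw [(hDe x hx).1]; rfl, ?_, (hDe x hx).2⟩⟩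
  refine ((sysMat_isVolterra hσ).norm_le_growth (F := fun _ => ((1, 0) : ℂ × ℂ)) zero_le_one hD
    (fun t _ => by simp) (x := T) (fun t ht => (hDe t ht).2) x hx).trans ?_
  rw [mul_one]
  exact mul_le_mul_of_nonneg_right (growth_le hx hσ hΩ) zero_le_two

theorem norm_cFun_le {T Ω : ℝ} (hT : 0 < T) {σ : ℝ → ℂ} (hσ : InL2 T σ)
    (hΩ : (normOn T σ).toReal ≤ Ω) {x : ℝ} (hx : x ∈ Icc 0 T) :
    ‖cFun T σ x‖ ≤ growthBound T Ω * 2 := by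
  obtain ⟨D, -, hD⟩ := cFun_bounds hT hσ hΩ
  rw [← (hD x hx).1]
  exact (norm_snd_le _).trans (hD x hx).2.1

theorem cFun_inL2 {T : ℝ} (hT : 0 < T) {σ : ℝ → ℂ} (hσ : InL2 T σ) : InL2 T (cFun T σ) := by
  obtain ⟨D, hDc, hD⟩ := cFun_bounds hT hσ le_rfl
  have hm : AEStronglyMeasurable (cFun T σ) (volume.restrict (Ioo 0 T)) := by
    refine (hDc.snd.aestronglyMeasurable (μ := volume.restrict (Ioo 0 T))).congr ?_
    filter_upwards [ae_restrict_mem measurableSet_Ioo] with t ht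
    exact (hD t (Ioo_subset_Icc_self ht)).1
  refine MemLp.of_bound hm (growthBound T (normOn T σ).toReal * 2) ?_
  filter_upwards [ae_restrict_mem measurableSet_Ioo] with t ht
  exact norm_cFun_le hT hσ le_rfl (Ioo_subset_Icc_self ht)

/-- The Lipschitz constant of `σ ↦ c(x)`. -/
noncomputable def cLip (T Ω : ℝ) : ℝ :=
  growthBound T Ω * (2 * (growthBound T Ω * 2 * (√T + 2 * Ω)))

theorem norm_cFun_sub_le {T Ω x : ℝ} (hT : 0 < T) {σ τ : ℝ → ℂ} (hσ : InL2 T σ)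
    (hτ : InL2 T τ) (hΩ : (normOn T σ).toReal ≤ Ω) (hΩ' : (normOn T τ).toReal ≤ Ω)
    (hx : x ∈ Icc 0 T) : ∀ t ∈ Icc 0 x,
      ‖cFun T σ t - cFun T τ t‖ ≤ cLip T Ω * (normOn x (σ - τ)).toReal := by
  have hΩ0 : 0 ≤ Ω := ENNReal.toReal_nonneg.trans hΩ
  obtain ⟨D, hDc, hD⟩ := cFun_bounds hT hσ hΩ
  obtain ⟨D', hDc', hD'⟩ := cFun_bounds hT hτ hΩ'
  intro t ht
  have m (s : ℝ) (hs : s ∈ Icc 0 x) : s ∈ Icc 0 T := ⟨hs.1, hs.2.trans hx.2⟩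
  have h := (sysMat_isVolterra hσ).norm_sub_le (sysMat_isVolterra hτ) (domDiff_integrable hσ hτ)
    (domDiff_nonneg T σ τ) (norm_sysMat_sub_le T σ τ) (F := fun _ => (1, 0)) (F' := fun _ => (1, 0))
    le_rfl (mul_nonneg (growthBound_pos T Ω).le zero_le_two) hDc hDc' (fun s _ => by simp)
    (fun s hs => (hD' s (m s hs)).2.1) (fun s hs => (hD s (m s hs)).2.2)
    (fun s hs => (hD' s (m s hs)).2.2) t ht
  rw [← (hD t (m t ht)).1, ← (hD' t (m t ht)).1]
  refine (norm_snd_le (D t - D' t)).trans (h.trans ?_)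
  have h1 := integral_domDiff_le hx hσ hτ hΩ hΩ'
  have h2 := growth_le (m t ht) hσ hΩ
  have hg := growthBound_pos T Ω
  have hd : 0 ≤ (normOn x (σ - τ)).toReal := ENNReal.toReal_nonneg
  have hs := Real.sqrt_nonneg T
  calc _ ≤ growthBound T Ω * (2 * (0 + growthBound T Ω * 2 *
        ((√T + 2 * Ω) * (normOn x (σ - τ)).toReal))) := by
        have : 0 ≤ ∫ s in (0:ℝ)..x, domDiff T σ τ s :=
          intervalIntegral.integral_nonneg hx.1 fun s _ => domDiff_nonneg T σ τ s
        gcongr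
    _ = _ := by rw [cLip]; ring

theorem normOn_cFun_sub_le {T Ω x : ℝ} (hT : 0 < T) {σ τ : ℝ → ℂ} (hσ : InL2 T σ)
    (hτ : InL2 T τ) (hΩ : (normOn T σ).toReal ≤ Ω) (hΩ' : (normOn T τ).toReal ≤ Ω)
    (hx : x ∈ Icc 0 T) : (normOn x (cFun T σ - cFun T τ)).toReal ≤
      √T * cLip T Ω * (normOn x (σ - τ)).toReal := by
  have h := norm_cFun_sub_le hT hσ hτ hΩ hΩ' hx
  have h0 := (norm_nonneg _).trans (h 0 ⟨le_rfl, hx.1⟩)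
  refine (normOn_le_of_bound hx.1 h0 fun t ht => h t (Ioo_subset_Icc_self ht)).trans ?_
  rw [mul_assoc]
  exact mul_le_mul_of_nonneg_right (Real.sqrt_le_sqrt hx.2) h0

theorem norm_kerSrc_le {T Ω Γ : ℝ} {σ c : ℝ → ℂ} (hσ : InL2 T σ) (hc : InL2 T c)
    {α β : ℂ} (hα : ‖α‖ ≤ 1) (hβ : ‖β‖ ≤ 1) (hΩ : (normOn T σ).toReal ≤ Ω)
    (hΓ : (normOn T c).toReal ≤ Γ) {x : ℝ} (hx : x ∈ Icc 0 T) :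
    ‖kerSrc T hσ hc α β x‖ ≤ Ω + Γ + √T := by
  have hs := Real.sqrt_nonneg T
  have hn : (normOn x (cut T σ)).toReal ≤ Ω := by
    rw [normOn_cut hx.2]; exact (normOn_toReal_mono hσ hx.2).trans hΩ
  have hn' : (normOn x (cut T c)).toReal ≤ Γ := by
    rw [normOn_cut hx.2]; exact (normOn_toReal_mono hc hx.2).trans hΓ
  have hΩ0 : 0 ≤ Ω := ENNReal.toReal_nonneg.trans hΩ
  have hΓ0 : 0 ≤ Γ := ENNReal.toReal_nonneg.trans hΓ
  have s1 (m : ℝ) (hm : 1 ≤ |m|) := (norm_src_le hm (cut_memLp hσ) x).trans hn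
  have s2 (m : ℝ) (hm : 1 ≤ |m|) := (norm_src_le hm (cut_memLp hc) x).trans hn'
  have s3 (m : ℝ) (hm : 1 ≤ |m|) := (norm_src_le hm (chi_memLp T) x).trans (normOn_chi_le hx)
  have sm (γ : ℂ) (hγ : ‖γ‖ ≤ 1) (f : LineL2) : ‖γ • f‖ ≤ ‖f‖ := by
    rw [norm_smul]; exact mul_le_of_le_one_left (norm_nonneg _) hγ
  rw [kerSrc, norm_prod_le_iff, norm_prod_le_iff]
  refine ⟨(norm_add_le _ _).trans ?_, (norm_add_le _ _).trans ?_, ?_⟩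
  · linarith [(sm β hβ _).trans (s1 (-2) (by norm_num)), s2 (-1) (by norm_num)]
  · linarith [(sm α hα _).trans (s1 2 (by norm_num)), s2 1 (by norm_num)]
  · rw [norm_smul, norm_half_I]
    linarith [norm_sub_le (α • src 1 (chi_memLp T) x) (β • src (-1) (chi_memLp T) x),
      (sm α hα _).trans (s3 1 (by norm_num)), (sm β hβ _).trans (s3 (-1) (by norm_num))]

theorem norm_kerSrc_sub_le {T : ℝ} {σ c τ b : ℝ → ℂ} (hσ : InL2 T σ) (hc : InL2 T c)
    (hτ : InL2 T τ) (hb : InL2 T b) {α β : ℂ} (hα : ‖α‖ ≤ 1) (hβ : ‖β‖ ≤ 1) {x : ℝ}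
    (hx : x ∈ Icc 0 T) : ‖kerSrc T hσ hc α β x - kerSrc T hτ hb α β x‖ ≤
      (normOn x (σ - τ)).toReal + (normOn x (c - b)).toReal := by
  have s1 (m : ℝ) (hm : 1 ≤ |m|) := norm_src_sub_le hm (cut_memLp hσ) (cut_memLp hτ) x
  have s2 (m : ℝ) (hm : 1 ≤ |m|) := norm_src_sub_le hm (cut_memLp hc) (cut_memLp hb) x
  rw [cut_sub, normOn_cut hx.2] at s1 s2
  have sm (γ : ℂ) (hγ : ‖γ‖ ≤ 1) (f : LineL2) : ‖γ • f‖ ≤ ‖f‖ := by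
    rw [norm_smul]; exact mul_le_of_le_one_left (norm_nonneg _) hγ
  have e (γ : ℂ) (f g f' g' : LineL2) : (γ • f + g) - (γ • f' + g') = γ • (f - f') + (g - g') := by
    rw [smul_sub]; abel
  rw [kerSrc, kerSrc, Prod.mk_sub_mk, Prod.mk_sub_mk, norm_prod_le_iff, norm_prod_le_iff, e, e,
    sub_self, norm_zero]
  exact ⟨(norm_add_le _ _).trans (add_le_add ((sm β hβ _).trans (s1 (-2) (by norm_num)))
      (s2 (-1) (by norm_num))),
    (norm_add_le _ _).trans (add_le_add ((sm α hα _).trans (s1 2 (by norm_num)))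
      (s2 1 (by norm_num))), add_nonneg ENNReal.toReal_nonneg ENNReal.toReal_nonneg⟩

/-- The Lipschitz constant of the kernels. -/
noncomputable def kerLip (T Ω Γ E : ℝ) : ℝ :=
  growthBound T Ω * (2 * (1 + E + growthBound T Ω * (2 * (Ω + Γ + √T)) * (√T + 2 * Ω)))

/-- In `kerLip`, `1 + E` is the change of the sources (`σ` and the forcing term), and the remaining
summand is the a priori bound of `W` times the change of the coefficients. -/
theorem IsKernel.norm_sub_le {T Ω Γ E : ℝ} {σ c τ b : ℝ → ℂ} {hσ : InL2 T σ} {hc : InL2 T c}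
    {hτ : InL2 T τ} {hb : InL2 T b} {α β : ℂ} (hα : ‖α‖ ≤ 1) (hβ : ‖β‖ ≤ 1) {Y W : ℝ → Triple}
    (hY : IsKernel T hσ hc α β Y) (hW : IsKernel T hτ hb α β W)
    (hΩ : (normOn T σ).toReal ≤ Ω) (hΩ' : (normOn T τ).toReal ≤ Ω)
    (hΓ : (normOn T b).toReal ≤ Γ) {x : ℝ} (hx : x ∈ Icc 0 T)
    (hE : (normOn x (c - b)).toReal ≤ E * (normOn x (σ - τ)).toReal) :
    ‖Y x - W x‖ ≤ kerLip T Ω Γ E * (normOn x (σ - τ)).toReal := by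
  have hΩ0 : 0 ≤ Ω := ENNReal.toReal_nonneg.trans hΩ
  have hΓ0 : 0 ≤ Γ := ENNReal.toReal_nonneg.trans hΓ
  have hs := Real.sqrt_nonneg T
  have hg := growthBound_pos T Ω
  set d := (normOn x (σ - τ)).toReal with hd
  have hd0 : 0 ≤ d := ENNReal.toReal_nonneg
  have m (s : ℝ) (hs : s ∈ Icc 0 x) : s ∈ Icc 0 T := ⟨hs.1, hs.2.trans hx.2⟩
  have hWM (t : ℝ) (ht : t ∈ Icc 0 T) : ‖W t‖ ≤ growthBound T Ω * (2 * (Ω + Γ + √T)) := by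
    refine ((kerOp_isVolterra hτ).norm_le_growth (F := kerSrc T hτ hb α β) (by positivity)
      hW.continuous (fun s hs => norm_kerSrc_le hτ hb hα hβ hΩ' hΓ hs) hW.eqn t ht).trans ?_
    exact mul_le_mul_of_nonneg_right (growth_le ht hτ hΩ') (by positivity)
  have hst : InL2 x (σ - τ) := InL2.mono (MemLp.sub hσ hτ : InL2 T (σ - τ)) hx.2
  have hcb : InL2 x (c - b) := InL2.mono (MemLp.sub hc hb : InL2 T (c - b)) hx.2
  have h := (kerOp_isVolterra hσ).norm_sub_le (kerOp_isVolterra hτ) (domDiff_integrable hσ hτ)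
    (domDiff_nonneg T σ τ) (norm_kerOp_sub_le T σ τ) (F := kerSrc T hσ hc α β)
    (F' := kerSrc T hτ hb α β) (f := d + (normOn x (c - b)).toReal)
    (add_nonneg hd0 ENNReal.toReal_nonneg) (by positivity) hY.continuous hW.continuous
    -- Sources at `s ≤ x` involve only `(0, s)`; this causality puts the norm over `(0, x)`, and not
    -- over `(0, T)`, into the result.
    (fun s hs => (norm_kerSrc_sub_le hσ hc hτ hb hα hβ (m s hs)).trans
      (add_le_add (normOn_toReal_mono hst hs.2) (normOn_toReal_mono hcb hs.2)))
    (fun s hs => hWM s (m s hs)) (fun s hs => hY.eqn s (m s hs))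
    (fun s hs => hW.eqn s (m s hs)) x ⟨hx.1, le_rfl⟩
  refine h.trans ?_
  have h1 := integral_domDiff_le hx hσ hτ hΩ hΩ'
  have h2 := growth_le hx hσ hΩ
  have h3 : 0 ≤ ∫ s in (0:ℝ)..x, domDiff T σ τ s :=
    intervalIntegral.integral_nonneg hx.1 fun s _ => domDiff_nonneg T σ τ s
  have h4 : 0 ≤ (normOn x (c - b)).toReal := ENNReal.toReal_nonneg
  calc _ ≤ growthBound T Ω * (2 * (d + E * d + growthBound T Ω * (2 * (Ω + Γ + √T)) *
        ((√T + 2 * Ω) * d))) := by gcongr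
    _ = _ := by rw [kerLip]; ring

theorem norm_yKer_sub_le (Y W : ℝ → Triple) (x : ℝ) : ‖yKer Y x - yKer W x‖ ≤ ‖Y x - W x‖ := by
  have h1 := norm_fst_le_triple (Y x - W x)
  have h2 := norm_snd_fst_le_triple (Y x - W x)
  have e : yKer Y x - yKer W x =
      (1 / 2 : ℂ) • (trans x (Y x - W x).1 + trans (-x) (Y x - W x).2.1) := by
    simp only [yKer, Prod.fst_sub, Prod.snd_sub, map_sub, ← smul_sub]
    congr 1
    abel
  have h3 := norm_add_le (trans x (Y x - W x).1) (trans (-x) (Y x - W x).2.1)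
  rw [LinearIsometry.norm_map, LinearIsometry.norm_map] at h3
  rw [e, norm_smul, show ‖(1 / 2 : ℂ)‖ = 1 / 2 by norm_num]
  linarith

theorem norm_vKer_sub_le (Y W : ℝ → Triple) (x : ℝ) : ‖vKer Y x - vKer W x‖ ≤ ‖Y x - W x‖ := by
  have h1 := norm_fst_le_triple (Y x - W x)
  have h2 := norm_snd_fst_le_triple (Y x - W x)
  have e : vKer Y x - vKer W x =
      (Complex.I / 2) • (trans x (Y x - W x).1 - trans (-x) (Y x - W x).2.1) := by
    simp only [vKer, Prod.fst_sub, Prod.snd_sub, map_sub, ← smul_sub]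
    congr 1
    abel
  have h3 := _root_.norm_sub_le (trans x (Y x - W x).1) (trans (-x) (Y x - W x).2.1)
  rw [LinearIsometry.norm_map, LinearIsometry.norm_map] at h3
  rw [e, norm_smul, norm_half_I]
  linarith

/-! ### Folding the kernels to cosine and sine transforms on `(0, x)`. -/

theorem integrable_mul_of_mem_suppIn {a b : ℝ} {f : LineL2} (hf : f ∈ suppIn a b) {G : ℝ → ℂ}
    (hG : Continuous G) : Integrable fun s => G s * f s := by
  have h1 : IntegrableOn (fun s => G s * f s) (Icc a b) :=
    (integrable_of_mem_suppIn hf).integrableOn.continuousOn_mul hG.continuousOn isCompact_Icc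
  refine (h1.integrable_indicator measurableSet_Icc).congr ?_
  filter_upwards [mem_suppIn.1 hf] with s hs
  by_cases h : s ∈ Icc a b
  · rw [indicator_of_mem h]
  · rw [indicator_of_notMem h, hs h, mul_zero]

theorem integral_mul_eq_fold {x : ℝ} (hx : 0 ≤ x) {f : LineL2} (hf : f ∈ suppIn (-x) x) {G : ℝ → ℂ}
    (hG : Continuous G) : ∫ s, G s * f s =
      ∫ t in (0:ℝ)..x, (G t * f t + G (-t) * f (-t)) := by
  have hI := integrable_mul_of_mem_suppIn hf hG
  have hi (a b : ℝ) : IntervalIntegrable (fun s => G s * f s) volume a b := hI.intervalIntegrable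
  have hi' : IntervalIntegrable (fun s => G (-s) * f (-s)) volume 0 x :=
    hI.comp_neg.intervalIntegrable
  rw [intervalIntegral.integral_add (hi 0 x) hi',
    intervalIntegral.integral_comp_neg (fun s => G s * f s), neg_zero, add_comm,
    intervalIntegral.integral_add_adjacent_intervals (hi _ _) (hi _ _),
    intervalIntegral.integral_of_le (by linarith), ← integral_Icc_eq_integral_Ioc,
    ← integral_indicator measurableSet_Icc]
  refine integral_congr_ae ?_
  filter_upwards [mem_suppIn.1 hf] with s hs
  by_cases h : s ∈ Icc (-x) x
  · rw [indicator_of_mem h]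
  · rw [indicator_of_notMem h, hs h, mul_zero]

/-- The combination `a f(s) + b f(-s)`. -/
noncomputable def reflect (a b : ℂ) (f : ℝ → ℂ) (s : ℝ) : ℂ := a * f s + b * f (-s)

/-- Averaging the transforms at `ρ` and `-ρ` replaces the exponential by the cosine, and the
integral over `(-x, x)` is then folded at `0`. Symmetry of `f` itself is not required. -/
theorem fhat_eq_cos {x : ℝ} (hx : 0 ≤ x) {f : LineL2} (hf : f ∈ suppIn (-x) x) {ρ : ℂ}
    (h : fhat (-ρ) f = fhat ρ f) :
    fhat ρ f = ∫ t in (0:ℝ)..x, reflect 1 1 f t * Complex.cos (ρ * t) := by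
  have hint (ρ : ℂ) : Integrable fun s : ℝ => Complex.exp (Complex.I * ρ * s) * f s :=
    integrable_mul_of_mem_suppIn hf (by fun_prop)
  have h1 : fhat ρ f = ∫ s : ℝ, Complex.cos (ρ * s) * f s := by
    have : fhat ρ f = (fhat ρ f + fhat (-ρ) f) / 2 := by rw [h]; ring
    rw [this, fhat, fhat, ← integral_add (hint _) (hint _), ← integral_div]
    refine integral_congr_ae (Eventually.of_forall fun s => ?_)
    simp only [cos_eq_wave, wave]
    push_cast
    ring_nf
  rw [h1, integral_mul_eq_fold hx hf (by fun_prop)]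
  refine intervalIntegral.integral_congr fun t _ => ?_
  simp only [reflect, Complex.ofReal_neg, mul_neg, Complex.cos_neg]
  ring

theorem fhat_eq_sin {x : ℝ} (hx : 0 ≤ x) {f : LineL2} (hf : f ∈ suppIn (-x) x) {ρ : ℂ}
    (h : fhat (-ρ) f = -fhat ρ f) :
    fhat ρ f = ∫ t in (0:ℝ)..x, reflect Complex.I (-Complex.I) f t * Complex.sin (ρ * t) := by
  have hint (ρ : ℂ) : Integrable fun s : ℝ => Complex.exp (Complex.I * ρ * s) * f s :=
    integrable_mul_of_mem_suppIn hf (by fun_prop)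
  have h1 : fhat ρ f = ∫ s : ℝ, Complex.I * Complex.sin (ρ * s) * f s := by
    have : fhat ρ f = (fhat ρ f - fhat (-ρ) f) / 2 := by rw [h]; ring
    rw [this, fhat, fhat, ← integral_sub (hint _) (hint _), ← integral_div]
    refine integral_congr_ae (Eventually.of_forall fun s => ?_)
    simp only [sin_eq_wave, wave]
    push_cast
    ring_nf
    rw [Complex.I_sq]
    ring
  rw [h1, integral_mul_eq_fold hx hf (by fun_prop)]
  refine intervalIntegral.integral_congr fun t _ => ?_
  simp only [reflect, Complex.ofReal_neg, mul_neg, Complex.sin_neg]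
  ring

theorem reflect_memLp (a b : ℂ) (f : LineL2) : MemLp (reflect a b f) 2 volume :=
  ((Lp.memLp f).const_mul a).add (((Lp.memLp f).comp_measurePreserving
    (Measure.measurePreserving_neg volume)).const_mul b)

theorem normOn_reflect_sub_le {a b : ℂ} (ha : ‖a‖ ≤ 1) (hb : ‖b‖ ≤ 1) (f g : LineL2) (x : ℝ) :
    normOn x (reflect a b f - reflect a b g) ≤ ENNReal.ofReal (2 * ‖f - g‖) := by
  have hmp := Measure.measurePreserving_neg (volume : Measure ℝ)
  have he := Lp.coeFn_sub f g
  have e : reflect a b f - reflect a b g =ᵐ[volume]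
      a • ((f - g : LineL2) : ℝ → ℂ) + b • (((f - g : LineL2) : ℝ → ℂ) ∘ Neg.neg) := by
    filter_upwards [he, hmp.quasiMeasurePreserving.ae he] with s h1 h2
    simp only [reflect, Pi.sub_apply, Pi.add_apply, Pi.smul_apply, smul_eq_mul, Function.comp, h1, h2]
    ring
  have hm := Lp.memLp (f - g)
  have hm' := hm.comp_measurePreserving hmp
  have h0 : eLpNorm ((f - g : LineL2) : ℝ → ℂ) 2 volume = ENNReal.ofReal ‖f - g‖ := by
    rw [ofReal_norm, Lp.enorm_def]
  have hs (a : ℂ) (ha : ‖a‖ ≤ 1) (h : ℝ → ℂ) : eLpNorm (a • h) 2 volume ≤ eLpNorm h 2 volume := by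
    rw [eLpNorm_const_smul]
    refine mul_le_of_le_one_left' ?_
    rw [← ofReal_norm]
    exact ENNReal.ofReal_le_one.2 ha
  calc normOn x (reflect a b f - reflect a b g)
      ≤ eLpNorm (reflect a b f - reflect a b g) 2 volume := eLpNorm_restrict_le _ _ _ _
    _ ≤ _ := by rw [eLpNorm_congr_ae e]
    _ ≤ _ := eLpNorm_add_le (hm.const_smul a).1 (hm'.const_smul b).1 one_le_two
    _ ≤ ENNReal.ofReal ‖f - g‖ + ENNReal.ofReal ‖f - g‖ := by
        refine add_le_add ((hs a ha _).trans h0.le) ((hs b hb _).trans ?_)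
        rw [eLpNorm_comp_measurePreserving hm.1 hmp, h0]
    _ = _ := by rw [← ENNReal.ofReal_add (norm_nonneg _) (norm_nonneg _), two_mul]

theorem fhat_sub {a b : ℝ} {f g : LineL2} (hf : f ∈ suppIn a b) (hg : g ∈ suppIn a b) (ρ : ℂ) :
    fhat ρ (f - g : LineL2) = fhat ρ f - fhat ρ g := by
  have hR (h : LineL2) (hh : h ∈ suppIn a b) : h ∈ suppIn (-(max |a| |b|)) (max |a| |b|) := by
    refine suppIn_mono ?_ ?_ hh
    · linarith [neg_abs_le a, le_max_left |a| |b|]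
    · exact (le_abs_self b).trans (le_max_right _ _)
  rw [← fhatCLM_eq ρ (hR _ (sub_mem hf hg)), ← fhatCLM_eq ρ (hR _ hf), ← fhatCLM_eq ρ (hR _ hg),
    map_sub]

/-! ### Representations of the solutions, and the theorem. -/

section
variable {T : ℝ} {σ : ℝ → ℂ} {x : ℝ}

theorem phi_representation (hT : 0 < T) {hσ : InL2 T σ} {hc : InL2 T (cFun T σ)} {Y : ℝ → Triple}
    (hY : IsKernel T hσ hc 1 1 Y) (hx : x ∈ Icc 0 T) (ρ : ℂ) :
    phi T σ x (ρ ^ 2) = Complex.cos (ρ * x) + fhat ρ (yKer Y x) ∧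
    (phiQuasi T σ x (ρ ^ 2) - cFun T σ x) / ρ = -Complex.sin (ρ * x) + fhat ρ (vKer Y x) := by
  obtain ⟨h, h1, h0⟩ := cauchySol_spec hT hσ (ρ ^ 2) 1 0
  obtain ⟨k, k1, k0⟩ := cauchySol_spec hT hσ 0 1 0
  have hm := isModSol_phi h k (h1.trans k1.symm) (by
    intro hρ
    rw [hρ, zero_pow two_ne_zero]
    exact ⟨rfl, rfl⟩)
  have hr := hm.representation (hσ := hσ) (hc := hc) (Y := Y) hT (by
    simpa only [h1, h0, k0, sub_self, zero_div, mul_zero, sub_zero, add_zero] using hY) hx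
  simp only [h1, h0, k0, sub_self, zero_div, zero_mul, add_zero, one_mul, neg_mul] at hr
  exact hr

theorem sol_representation (hT : 0 < T) {hσ : InL2 T σ} {hc : InL2 T 0} {Y : ℝ → Triple}
    (hY : IsKernel T hσ hc (-Complex.I) Complex.I Y) (hx : x ∈ Icc 0 T) (ρ : ℂ) :
    ρ * sol T σ x (ρ ^ 2) = Complex.sin (ρ * x) + fhat ρ (yKer Y x) ∧
    solQuasi T σ x (ρ ^ 2) = Complex.cos (ρ * x) + fhat ρ (vKer Y x) := by
  obtain ⟨h, h1, h0⟩ := cauchySol_spec hT hσ (ρ ^ 2) 0 1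
  have hm := isModSol_sol h h1
  have hr := hm.representation (hσ := hσ) (hc := hc) (Y := Y) hT (by
    simpa only [h1, h0, mul_zero, mul_one, zero_sub, zero_add] using hY) hx
  simp only [h1, h0, mul_zero, zero_mul, neg_zero, zero_add, one_mul] at hr
  exact hr

/-- Thus `η(x, ·)` is exactly the transform of the kernel of `v`. The identity includes `ρ = 0`,
where both quotients vanish by convention. -/
theorem eta_eq_fhat (hT : 0 < T) {hσ : InL2 T σ} {hc : InL2 T (cFun T σ)} {Y : ℝ → Triple}
    (hY : IsKernel T hσ hc 1 1 Y) (hx : x ∈ Icc 0 T) (ρ : ℂ) :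
    eta T σ x ρ = fhat ρ (vKer Y x) := by
  have h := (phi_representation hT hY hx ρ).2
  rw [← sub_eq_iff_eq_add'.2 h, eta]
  rcases eq_or_ne ρ 0 with rfl | hρ
  · simp
  · field_simp
    ring

theorem isTransformationPair (hT : 0 < T) {hσ : InL2 T σ} {hc : InL2 T (cFun T σ)} {Y : ℝ → Triple}
    (hY : IsKernel T hσ hc 1 1 Y) (hx : x ∈ Icc 0 T) :
    IsTransformationPair T σ x (reflect 1 1 (yKer Y x))
      (reflect Complex.I (-Complex.I) (vKer Y x)) where
  memLp_left := (reflect_memLp _ _ _).restrict _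
  memLp_right := (reflect_memLp _ _ _).restrict _
  phi_eq ρ := by
    have h := (phi_representation hT hY hx ρ).1
    -- `φ(x, ρ²)` and the cosine are even in `ρ`, so the transform of the kernel is even as well.
    have h' := (phi_representation hT hY hx (-ρ)).1
    rw [neg_sq, neg_mul, Complex.cos_neg, h] at h'
    rw [h, fhat_eq_cos hx.1 (hY.yKer_mem hx) (add_left_cancel h').symm]
  phiQuasi_eq ρ := by
    have h := (phi_representation hT hY hx ρ).2
    -- The quotient by `ρ` and the sine are odd, so the transform of the kernel of `v` is odd.
    have h' := (phi_representation hT hY hx (-ρ)).2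
    rw [neg_sq, neg_mul, Complex.sin_neg, div_neg, h] at h'
    rw [← fhat_eq_sin hx.1 (hY.vKer_mem hx) (by linear_combination -h')]
    rcases eq_or_ne ρ 0 with rfl | hρ
    · simp [cFun]
    · rw [div_eq_iff hρ] at h
      linear_combination h

end

/-- A choice of the solution of the Volterra equation for `φ`. -/
noncomputable def phiCurve (T : ℝ) (σ : ℝ → ℂ) : ℝ → Triple :=
  Classical.epsilon fun Y => ∃ (hσ : InL2 T σ) (hc : InL2 T (cFun T σ)), IsKernel T hσ hc 1 1 Y

theorem phiCurve_spec {T : ℝ} (hT : 0 < T) {σ : ℝ → ℂ} (hσ : InL2 T σ) :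
    IsKernel T hσ (cFun_inL2 hT hσ) 1 1 (phiCurve T σ) := by
  obtain ⟨Y, hY⟩ := exists_isKernel hT.le hσ (cFun_inL2 hT hσ) 1 1
  obtain ⟨_, _, h⟩ := Classical.epsilon_spec
    (p := fun Y => ∃ (hσ : InL2 T σ) (hc : InL2 T (cFun T σ)), IsKernel T hσ hc 1 1 Y)
    ⟨Y, hσ, cFun_inL2 hT hσ, hY⟩
  exact h

/-- All four bounds on the line have this form; the extra term `e` is `|ĉ(x)|` for `η` and `0`
otherwise. -/
theorem l2LineBound_fhat {a b L D : ℝ} {C n : ℝ≥0∞} {e : ℝ≥0∞} {f g : LineL2}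
    (hf : f ∈ suppIn a b) (hg : g ∈ suppIn a b) {F : ℝ → ℂ}
    (hF : ∀ ρ : ℝ, F ρ = fhat ρ f - fhat ρ g) (hfg : ‖f - g‖ ≤ L * n.toReal) (hn : n ≠ ∞)
    (he : e ≤ ENNReal.ofReal D * n) (hC : ENNReal.ofReal (2 * Real.pi * L) + ENNReal.ofReal D ≤ C) :
    L2LineBound F e (C * n) := by
  obtain ⟨h1, h2⟩ := fhat_memLp (sub_mem hf hg)
  have e1 : F = fun ρ : ℝ => fhat ρ (f - g : LineL2) := funext fun ρ => by rw [hF, fhat_sub hf hg]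
  rw [e1]
  refine ⟨h1, ?_⟩
  have h3 : ENNReal.ofReal (2 * Real.pi * ‖f - g‖) ≤ ENNReal.ofReal (2 * Real.pi * L) * n := by
    refine (ENNReal.ofReal_le_ofReal (mul_le_mul_of_nonneg_left hfg
      (by positivity))).trans (le_of_eq ?_)
    rw [← mul_assoc, ENNReal.ofReal_mul' ENNReal.toReal_nonneg, ENNReal.ofReal_toReal hn]
  refine (add_le_add (h2.trans h3) he).trans ?_
  rw [← add_mul]
  exact mul_le_mul_left hC _

end SturmLiouville

theorem mainTheorem6 (T : ℝ) (hT : 0 < T) :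
    ∃ K N : (ℝ → ℂ) → ℝ → ℝ → ℂ,
      (∀ σ : ℝ → ℂ, InL2 T σ → ∀ x ∈ Ioc 0 T, IsTransformationPair T σ x (K σ x) (N σ x)) ∧
      ∀ Ω : ℝ, 0 < Ω → ∃ C : ℝ≥0, ∀ σ τ : ℝ → ℂ, InL2 T σ → InL2 T τ →
        normOn T σ ≤ ENNReal.ofReal Ω → normOn T τ ≤ ENNReal.ofReal Ω → ∀ x ∈ Ioc 0 T,
          L2LineBound (fun ρ => ρ * (sol T σ x (ρ ^ 2) - sol T τ x (ρ ^ 2))) 0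
            (C * normOn x (σ - τ)) ∧
          L2LineBound (fun ρ => solQuasi T σ x (ρ ^ 2) - solQuasi T τ x (ρ ^ 2)) 0
            (C * normOn x (σ - τ)) ∧
          L2LineBound (fun ρ => phi T σ x (ρ ^ 2) - phi T τ x (ρ ^ 2)) 0
            (C * normOn x (σ - τ)) ∧
          L2LineBound (fun ρ => eta T σ x ρ - eta T τ x ρ) ‖cFun T σ x - cFun T τ x‖ₑ
            (C * normOn x (σ - τ)) ∧
          normOn x (K σ x - K τ x) ≤ C * normOn x (σ - τ) ∧
          normOn x (N σ x - N τ x) ≤ C * normOn x (σ - τ) := by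
  refine ⟨fun σ x => reflect 1 1 (yKer (phiCurve T σ) x),
    fun σ x => reflect Complex.I (-Complex.I) (vKer (phiCurve T σ) x),
    fun σ hσ x hx => isTransformationPair hT (phiCurve_spec hT hσ) (Ioc_subset_Icc_self hx),
    fun Ω hΩ => ?_⟩
  set Γ := √T * (growthBound T Ω * 2) with hΓ
  set E := √T * cLip T Ω with hE
  set L := kerLip T Ω Γ E with hL
  have hg := growthBound_pos T Ω
  have hc0 : 0 ≤ cLip T Ω := by unfold cLip; positivity
  have hL0 : 0 ≤ L := by rw [hL, kerLip]; positivity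
  have hpi := Real.pi_gt_three
  -- `2πL` is the Plancherel factor times the Lipschitz constant of the kernels; `cLip` pays for
  -- `|ĉ(x)|`.
  refine ⟨(2 * Real.pi * L).toNNReal + (cLip T Ω).toNNReal, fun σ τ hσ hτ hσΩ hτΩ x hx => ?_⟩
  rw [ENNReal.coe_add]
  change _ ∧ _ ∧ _ ∧ L2LineBound _ _ ((ENNReal.ofReal (2 * Real.pi * L) +
    ENNReal.ofReal (cLip T Ω)) * _) ∧ _ ∧ _
  have hx' : x ∈ Icc 0 T := Ioc_subset_Icc_self hx
  have hσr := ENNReal.toReal_le_of_le_ofReal hΩ.le hσΩ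
  have hτr := ENNReal.toReal_le_of_le_ofReal hΩ.le hτΩ
  have hn : normOn x (σ - τ) ≠ ∞ := (InL2.mono (MemLp.sub hσ hτ : InL2 T (σ - τ)) hx.2).2.ne
  have hΓ0 : 0 ≤ Γ := by positivity
  have hE0 : 0 ≤ E := by positivity
  have hY := phiCurve_spec hT hσ
  have hW := phiCurve_spec hT hτ
  have hcΓ : (normOn T (cFun T τ)).toReal ≤ Γ := normOn_le_of_bound hT.le (by positivity)
    fun t ht => norm_cFun_le hT hτ hτr (Ioo_subset_Icc_self ht)
  have hYW := hY.norm_sub_le (by simp) (by simp) hW hσr hτr hcΓ hx'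
    (normOn_cFun_sub_le hT hσ hτ hσr hτr hx')
  -- For `S` the initial values `y = 0`, `v = 1` give `y ∓ iv = ∓i`. There is no forcing term;
  -- keeping the same `Γ` and `E` lets the constant `L` serve both solutions.
  obtain ⟨Y, hYs⟩ := exists_isKernel hT.le hσ (c := 0) MemLp.zero (-Complex.I) Complex.I
  obtain ⟨W, hWs⟩ := exists_isKernel hT.le hτ (c := 0) MemLp.zero (-Complex.I) Complex.I
  have hYWs := hYs.norm_sub_le (E := E) (by simp) (by simp) hWs hσr hτr (Γ := Γ)
    (by simpa [normOn] using hΓ0) hx'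
    (by simpa [normOn] using mul_nonneg hE0 ENNReal.toReal_nonneg)
  have hC : ENNReal.ofReal (2 * Real.pi * L) + ENNReal.ofReal (cLip T Ω) ≤
    ENNReal.ofReal (2 * Real.pi * L) + ENNReal.ofReal (cLip T Ω) := le_rfl
  have hker (f g : LineL2) (hfg : ‖f - g‖ ≤ L * (normOn x (σ - τ)).toReal) :
      ENNReal.ofReal (2 * ‖f - g‖) ≤ (ENNReal.ofReal (2 * Real.pi * L) +
        ENNReal.ofReal (cLip T Ω)) * normOn x (σ - τ) := by
    -- The factor `2` from folding is absorbed by `2π`.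
    have h1 : 2 * ‖f - g‖ ≤ 2 * Real.pi * L * (normOn x (σ - τ)).toReal := by
      have := mul_nonneg hL0 (ENNReal.toReal_nonneg (a := normOn x (σ - τ)))
      nlinarith
    refine (ENNReal.ofReal_le_ofReal h1).trans ?_
    rw [ENNReal.ofReal_mul' ENNReal.toReal_nonneg, ENNReal.ofReal_toReal hn]
    exact mul_le_mul_left le_self_add _
  refine ⟨?_, ?_, ?_, ?_, ?_, ?_⟩
  · refine l2LineBound_fhat (hYs.yKer_mem hx') (hWs.yKer_mem hx') (fun ρ => ?_)
      ((norm_yKer_sub_le Y W x).trans hYWs) hn zero_le hC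
    rw [mul_sub, (sol_representation hT hYs hx' ρ).1, (sol_representation hT hWs hx' ρ).1]
    ring
  · refine l2LineBound_fhat (hYs.vKer_mem hx') (hWs.vKer_mem hx') (fun ρ => ?_)
      ((norm_vKer_sub_le Y W x).trans hYWs) hn zero_le hC
    rw [(sol_representation hT hYs hx' ρ).2, (sol_representation hT hWs hx' ρ).2]
    ring
  · refine l2LineBound_fhat (hY.yKer_mem hx') (hW.yKer_mem hx') (fun ρ => ?_)
      ((norm_yKer_sub_le _ _ x).trans hYW) hn zero_le hC
    rw [(phi_representation hT hY hx' ρ).1, (phi_representation hT hW hx' ρ).1]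
    ring
  · refine l2LineBound_fhat (hY.vKer_mem hx') (hW.vKer_mem hx') (fun ρ => ?_)
      ((norm_vKer_sub_le _ _ x).trans hYW) hn ?_ hC
    · rw [eta_eq_fhat hT hY hx', eta_eq_fhat hT hW hx']
    · have h := norm_cFun_sub_le hT hσ hτ hσr hτr hx' x ⟨hx'.1, le_rfl⟩
      rw [← ofReal_norm]
      refine (ENNReal.ofReal_le_ofReal h).trans (le_of_eq ?_)
      rw [ENNReal.ofReal_mul' ENNReal.toReal_nonneg, ENNReal.ofReal_toReal hn]
  · exact (normOn_reflect_sub_le (by simp) (by simp) _ _ x).trans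
      (hker _ _ ((norm_yKer_sub_le _ _ x).trans hYW))
  · exact (normOn_reflect_sub_le (by simp) (by simp) _ _ x).trans
      (hker _ _ ((norm_vKer_sub_le _ _ x).trans hYW))
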